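/- Let $\mathfrak g_0$ be a real topological Lie algebra (a real Lie algebra with a Hausdorff vector space topology for which the bracket is continuous) that is linearly compact (every family of closed affine subspaces with the finite intersection property has nonempty intersection), and let $\mathfrak i_0\subseteq\mathfrak g_0$ be a closed subalgebra of finite codimension containing no nonzero ideal of $\mathfrak g_0$; that is, $(\mathfrak g_0,\mathfrak i_0)$ is a transitive pair. Let $V$ be a linear complement of $\mathfrak i_0$ in $\mathfrak g_0$ and $\pi:\mathfrak g_0\to V$ the projection along $\mathfrak i_0$. Let $\mathcal F=\prod_{h\ge 0}\mathrm{Sym}^h(V,\mathbb R)$ be the ring of real formal power series on $V$, let $\mathcal F_0$ be its maximal ideal of series vanishing at $0$, let $\mathrm{Der}(\mathcal F)=\mathcal F\otimes V$ be the Lie algebra and left $\mathcal F$-module of derivations of $\mathcal F$ (formal vector fields), let $\Theta(0)\in V$ be the value at $0$ of $\Theta\in\mathrm{Der}(\mathcal F)$, and let $\mathrm{Der}_0(\mathcal F)=\mathcal F_0\otimes V$ be the set of those vanishing at $0$. Let $\sum_{h\ge 0} b_ht^h=\frac{t}{1-e^{-t}}$. For $X\in\mathfrak g_0$ and a sequence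 $c=(c_h)$ with $c_0=1$ there are unique homogeneous polynomial maps $y_h:V\to V$ and $H_h:V\to\mathfrak i_0$ of degree $h$ $(h\ge 0)$ such that, degree by degree, $$\sum_{h\ge 0}c_h(\mathrm{ad}\,v)^h(X)=\sum_{h\ge 0}y_h(v)+\sum_{h\ge 0}\ \sum_{r+s=h}b_r(\mathrm{ad}\,v)^r(H_s(v)),\qquad v\in V.$$ Denote the formal vector field $\sum_h y_h$ by $R^*_X$ when $c_h=(-1)^hb_h$, and by $L^*_X$ when $c_h=b_h$, and set $\mathfrak g_0^*=\{R^*_X\mid X\in\mathfrak g_0\}$. Then: 1. The map $\mathfrak g_0\ni X\mapsto R^*_X\in\mathrm{Der}(\mathcal F)$ is injective, its image $\mathfrak g_0^*$ is a Lie subalgebra of $\mathrm{Der}(\mathcal F)$, and it is an anti-isomorphism of Lie algebras of $\mathfrak g_0$ onto $\mathfrak g_0^*$: it is linear and $R^*_{[X,Y]}=-[R^*_X,R^*_Y]$. 2. $\mathfrak i_0=\{X\in\mathfrak g_0\mid R^*_X\in\mathrm{Der}_0(\mathcal F)\}$. 3. The correspondence $\mathfrak l_0\mapsto\mathfrak l_0^*=\mathcal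 F\otimes\langle L^*_w\mid w\in V\cap\mathfrak l_0\rangle$, the left $\mathcal F$-submodule of $\mathrm{Der}(\mathcal F)$ generated by these $L^*_w$, is a bijection from the set of linear subspaces $\mathfrak l_0$ of $\mathfrak g_0$ with $\mathfrak i_0\subseteq\mathfrak l_0$ and $[\mathfrak i_0,\mathfrak l_0]\subseteq\mathfrak l_0$ onto the set of left $\mathcal F$-submodules $M$ of $\mathrm{Der}(\mathcal F)$ with $[\mathfrak g_0^*,M]\subseteq M$. Its inverse is $M\mapsto\{Y\in\mathfrak g_0\mid \pi(Y)=\Theta(0)\text{ for some }\Theta\in M\}$. -/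

import Mathlib

namespace TransitiveGeometry

noncomputable section

/-! ### Linearly compact topological Lie algebras and transitive pairs -/

/-- `g` is a Hausdorff topological vector space over `ℝ` with continuous Lie product. Only
continuity of each scalar multiplication `x ↦ c • x` is asked for, so that `ℝ` may carry its
usual topology as well as the discrete one. -/
structure IsTopologicalLieAlgebra (g : Type*) [LieRing g] [LieAlgebra ℝ g]
    [TopologicalSpace g] : Prop where
  isTopologicalAddGroup : IsTopologicalAddGroup g
  continuousConstSMul : ContinuousConstSMul ℝ g
  t2Space : T2Space g
  continuous_bracket : Continuous fun p : g × g => ⁅p.1, p.2⁆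

/-- Every family of closed affine subspaces of `g` with the finite intersection property has a
nonempty intersection. -/
def IsLinearlyCompact (g : Type*) [AddCommGroup g] [Module ℝ g] [TopologicalSpace g] : Prop :=
  ∀ S : Set (AffineSubspace ℝ g), (∀ A ∈ S, IsClosed (A : Set g)) →
    (∀ T : Finset (AffineSubspace ℝ g), (T : Set (AffineSubspace ℝ g)) ⊆ S →
      (⋂ A ∈ T, (A : Set g)).Nonempty) →
    (⋂ A ∈ S, (A : Set g)).Nonempty

/-- `(g, i)` is a transitive pair: `g` is a linearly compact topological Lie algebra and `i` is a
closed subalgebra of finite codimension containing no nonzero ideal of `g`. -/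
structure IsTransitivePair {g : Type*} [LieRing g] [LieAlgebra ℝ g] [TopologicalSpace g]
    (i : LieSubalgebra ℝ g) : Prop where
  isTopologicalLieAlgebra : IsTopologicalLieAlgebra g
  isLinearlyCompact : IsLinearlyCompact g
  isClosed : IsClosed (i : Set g)
  finiteDimensional_quotient : FiniteDimensional ℝ (g ⧸ i.toSubmodule)
  eq_bot_of_ideal : ∀ I : LieIdeal ℝ g, (I : Set g) ⊆ (i : Set g) → I = ⊥

/-! ### Formal power series and formal vector fields on a vector space

A basis `e : Basis ι ℝ V` with `ι` finite gives linear coordinates `x_j`, `j ∈ ι`, on `V`.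
Homogeneous polynomial maps of degree `h` from `V` to `W`, which are the elements of
`Symm^h(V, W)`, become sums of terms `x^m w_m` with `w_m ∈ W` and `|m| = h`. -/

/-- The local ring `𝓕` of formal power series on `V`, in the coordinates `x_j`. -/
abbrev FormalFun (ι : Type*) : Type _ := MvPowerSeries ι ℝ

/-- The formal power series `∑_m x^m w_m` on `V` with coefficients `w_m` in `W`. -/
abbrev FormalMap (ι W : Type*) : Type _ := (ι →₀ ℕ) → W

/-- The Lie algebra and left `𝓕`-module `Der(𝓕)` of formal vector fields. -/
abbrev FormalVF (ι : Type*) : Type _ := Derivation ℝ (FormalFun ι) (FormalFun ι)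

/-- The maximal ideal `𝓕₀` of formal power series vanishing at `0`. -/
def formalFun₀ (ι : Type*) : Ideal (FormalFun ι) :=
  RingHom.ker (MvPowerSeries.constantCoeff (σ := ι) (R := ℝ))

/-- `Der₀(𝓕) = 𝓕₀ ⊗ V`: the formal vector fields vanishing at `0`. -/
def der₀ (ι : Type*) : Submodule (FormalFun ι) (FormalVF ι) :=
  formalFun₀ ι • (⊤ : Submodule (FormalFun ι) (FormalVF ι))

section Coordinates

variable {ι V : Type*} [Fintype ι] [AddCommGroup V] [Module ℝ V]

/-- The coordinate `a_j ∈ 𝓕` of `a = ∑_j a_j e_j ∈ 𝓕 ⊗ V`. -/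
def coord (e : Module.Basis ι ℝ V) (a : FormalMap ι V) (j : ι) : FormalFun ι :=
  fun m => e.repr (a m) j

/-- The formal vector field `∑_j a_j ∂/∂x_j` with coefficient `a = ∑_j a_j e_j ∈ 𝓕 ⊗ V`. -/
def toDer (e : Module.Basis ι ℝ V) (a : FormalMap ι V) : FormalVF ι :=
  ∑ j, coord e a j • MvPowerSeries.pderiv ℝ j

/-- The value `Θ(0) ∈ V` of a formal vector field `Θ`: its components are the `Θ(x_j)(0)`. -/
def valueAtZero (e : Module.Basis ι ℝ V) : FormalVF ι →ₗ[ℝ] V where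
  toFun Θ := ∑ j, MvPowerSeries.constantCoeff (Θ (MvPowerSeries.X j)) • e j
  map_add' Θ Ξ := by simp [add_smul, Finset.sum_add_distrib]
  map_smul' c Θ := by
    simp [Finset.smul_sum, smul_smul]

end Coordinates

/-! ### The vector fields `R*_X` and `L*_X` -/

/-- The coefficients `b_h` of `t / (1 - exp (-t)) = ∑_h b_h t^h`: the power series inverse of
`(1 - exp (-t)) / t = ∑_n (-1)^n t^n / (n + 1)!`. -/
def b (h : ℕ) : ℝ :=
  PowerSeries.coeff h (PowerSeries.mk fun n : ℕ => (-1 : ℝ) ^ n / ((n + 1).factorial : ℝ))⁻¹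

theorem mk_b_mul :
    PowerSeries.mk b * (1 - PowerSeries.evalNegHom (PowerSeries.exp ℝ)) = PowerSeries.X := by
  have h1 : (1 : PowerSeries ℝ) - PowerSeries.evalNegHom (PowerSeries.exp ℝ) =
      PowerSeries.X * PowerSeries.mk fun n : ℕ => (-1 : ℝ) ^ n / ((n + 1).factorial : ℝ) := by
    ext n
    cases n with
    | zero =>
      simp only [PowerSeries.evalNegHom, map_sub, PowerSeries.coeff_rescale]
      simp
    | succ n =>
      simp [PowerSeries.evalNegHom, PowerSeries.coeff_succ_X_mul, PowerSeries.coeff_rescale,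
        PowerSeries.coeff_exp, PowerSeries.coeff_one, pow_succ, div_eq_mul_inv]
  have h2 : PowerSeries.mk b =
      (PowerSeries.mk fun n : ℕ => (-1 : ℝ) ^ n / ((n + 1).factorial : ℝ))⁻¹ := by
    ext n
    simp [b]
  rw [h1, h2, mul_left_comm, PowerSeries.inv_mul_cancel, mul_one]
  simp

section Fields

variable {g : Type*} [LieRing g] [LieAlgebra ℝ g] {i : LieSubalgebra ℝ g} {V : Submodule ℝ g}
  {ι : Type*} [Fintype ι]

/-- The projection `π : g → V` along `i`. -/
def proj (hV : IsCompl V i.toSubmodule) : g →ₗ[ℝ] V := Submodule.projectionOnto V i.toSubmodule hV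

/-- The constant formal map `v ↦ X`. -/
def constMap (X : g) : FormalMap ι g := fun m => if m = 0 then X else 0

/-- The formal map `v ↦ [v, Z(v)]`, where `v = ∑_j x_j e_j` is the variable in `V`. -/
def adVar (e : Module.Basis ι ℝ V) (Z : FormalMap ι g) : FormalMap ι g :=
  fun m => ∑ j, if m j = 0 then 0 else ⁅(e j : g), Z (m - Finsupp.single j 1)⁆

/-- Given `H_0, …, H_{h-1}`, the homogeneous formal map
`v ↦ c_h (ad v)^h (X) - ∑_{r < h} b_{r+1} (ad v)^{r+1} (H_{h-1-r}(v))` of degree `h`. -/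
def rhs (e : Module.Basis ι ℝ V) (c : ℕ → ℝ) (X : g) (h : ℕ)
    (H : (k : ℕ) → k < h → FormalMap ι g) : FormalMap ι g :=
  c h • (adVar e)^[h] (constMap X) -
    ∑ r : Fin h, b (r + 1) • (adVar e)^[r + 1] (H (h - 1 - r) (by have := r.2; omega))

/-- The homogeneous summands `H_h`, with values in `i`, of the solution `Y = ∑ y_h ∈ 𝓕 ⊗ V`,
`H = ∑ H_h ∈ 𝓕 ⊗ i` of
`∑_h c_h (ad v)^h (X) = ∑_h y_h(v) + ∑_h ∑_{r + s = h} b_r (ad v)^r (H_s(v))`. -/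
def isotropyPart (hV : IsCompl V i.toSubmodule) (e : Module.Basis ι ℝ V) (c : ℕ → ℝ) (X : g)
    (h : ℕ) : FormalMap ι g :=
  let T : FormalMap ι g := rhs e c X h fun k _ => isotropyPart hV e c X k
  fun m => T m - (proj hV (T m) : g)
termination_by h

/-- The homogeneous summands `y_h`, with values in `V`, of the solution of the same equation. -/
def fieldPart (hV : IsCompl V i.toSubmodule) (e : Module.Basis ι ℝ V) (c : ℕ → ℝ) (X : g)
    (h : ℕ) : FormalMap ι V :=
  fun m => proj hV (rhs e c X h (fun k _ => isotropyPart hV e c X k) m)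

/-- The series `∑_h y_h ∈ 𝓕 ⊗ V`. As `y_h` is homogeneous of degree `h`, its coefficient at the
monomial `x^m` is that of `y_{|m|}`. -/
def fieldSeries (hV : IsCompl V i.toSubmodule) (e : Module.Basis ι ℝ V) (c : ℕ → ℝ) (X : g) :
    FormalMap ι V :=
  fun m => fieldPart hV e c X m.degree m

/-- The formal vector field `R*_X`, obtained from `R_X(v) = ∑_h (-1)^h b_h (ad v)^h (X)`. -/
def Rstar (hV : IsCompl V i.toSubmodule) (e : Module.Basis ι ℝ V) (X : g) : FormalVF ι :=
  toDer e (fieldSeries hV e (fun h => (-1) ^ h * b h) X)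

/-- The formal vector field `L*_X`, obtained from `L_X(v) = ∑_h b_h (ad v)^h (X)`. -/
def Lstar (hV : IsCompl V i.toSubmodule) (e : Module.Basis ι ℝ V) (X : g) : FormalVF ι :=
  toDer e (fieldSeries hV e b X)

/-! ### The correspondence -/

/-- The set of `i`-submodules of `g` containing `i`. -/
def isotropySubmodules (i : LieSubalgebra ℝ g) : Set (Submodule ℝ g) :=
  {l | i.toSubmodule ≤ l ∧ ∀ X ∈ i, ∀ Y ∈ l, ⁅X, Y⁆ ∈ l}

/-- The set of left `𝓕`-submodules `M` of `Der(𝓕)` with `[R*_X, M] ⊆ M` for all `X ∈ g`. -/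
def invariantModules (hV : IsCompl V i.toSubmodule) (e : Module.Basis ι ℝ V) :
    Set (Submodule (FormalFun ι) (FormalVF ι)) :=
  {M | ∀ X : g, ∀ Θ ∈ M, ⁅Rstar hV e X, Θ⁆ ∈ M}

/-- `l ↦ l* = 𝓕 ⊗ ⟨L*_w | w ∈ V ∩ l⟩`, the left `𝓕`-submodule generated by these `L*_w`. -/
def toModule (hV : IsCompl V i.toSubmodule) (e : Module.Basis ι ℝ V) (l : Submodule ℝ g) :
    Submodule (FormalFun ι) (FormalVF ι) :=
  Submodule.span (FormalFun ι) (Lstar hV e '' {w : g | w ∈ V ∧ w ∈ l})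

/-- `M ↦ {Y ∈ g | π(Y) = Θ(0) for some Θ ∈ M}`. -/
def ofModule (hV : IsCompl V i.toSubmodule) (e : Module.Basis ι ℝ V)
    (M : Submodule (FormalFun ι) (FormalVF ι)) : Submodule ℝ g :=
  ((M.restrictScalars ℝ).map (valueAtZero e)).comap (proj hV)

theorem mem_ofModule (hV : IsCompl V i.toSubmodule) (e : Module.Basis ι ℝ V)
    (M : Submodule (FormalFun ι) (FormalVF ι)) (Y : g) :
    Y ∈ ofModule hV e M ↔ ∃ Θ ∈ M, proj hV Y = valueAtZero e Θ := by
  simp [ofModule, eq_comm]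

end Fields

end

end TransitiveGeometry

/-! Everything is read off from the Maurer-Cartan form of the formal exponential map on `V`, ω =
exp(-v) d exp(v) = ((1 - e^{-ad v}) / ad v) dv, a form with values in the series over `g` (`mc`,
`mcForm`). Applying (1 - e^{-t})/t at t = ad v to the defining equations cancels the factor ∑ b_r
(ad v)^r and leaves ω(R*_X) = e^{-ad v} X - H and ω(L*_X) = X - H', with H and H' in 𝓕 ⊗ i
(`mcForm_Rstar`, `mcForm_Lstar`). Since Θ ↦ ω(Θ) is injective modulo 𝓕 ⊗ i
(`eq_zero_of_mcForm_mem`), identities between vector fields need only be checked on ω modulo 𝓕 ⊗ i.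

The Maurer-Cartan equation (`mcForm_lie`) and d(e^{-ad v} X) = -[ω, e^{-ad v} X] give the main
congruence ω([R*_X, Θ]) ≡ R*_X(ω(Θ)) - [H, ω(Θ)] (`mcForm_Rstar_lie_sub`). For Θ = R*_Y it is the
anti-homomorphism property. As R*_X(0) = π(X), the field R*_X vanishes at 0 exactly for X in `i`;
the kernel of X ↦ R*_X is thus an ideal inside `i`, hence zero.

For the correspondence, l* consists of the Θ with ω(Θ) ∈ 𝓕 ⊗ l (`mem_toModule_iff`), so its
invariance follows from the congruence. Conversely, let M be invariant with l its space of values at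
0, enlarged by `i`. Bracketing with R*_{e_j}, which is ∂/∂x_j up to terms vanishing at 0, shows
degree by degree that M ⊆ l* (`mcForm_apply_mem_ofModule`). Both modules have the same values at 0,
and Nakayama's lemma gives M = l*. -/

namespace TransitiveGeometry

noncomputable section

open scoped Classical
open Finset hiding mem_antidiagonal antidiagonal
open HasAntidiagonal

set_option linter.unusedSectionVars false

/-! ### Formal power series with coefficients in a vector space or in a Lie algebra -/

/-- The `𝓕`-module of formal power series with coefficients in `W`. It is `FormalMap ι W`, as a
type that carries the convolution structures. -/
def Series (ι W : Type*) : Type _ := (ι →₀ ℕ) → W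

/-! ### Reindexing of sums over decompositions into three terms. -/

section TripleSums

variable {A M : Type*} [AddCommMonoid A] [HasAntidiagonal A] [AddCommMonoid M]

theorem sum_antidiagonal_assoc (m : A) (f : A → A → A → M) :
    ∑ p ∈ antidiagonal m, ∑ q ∈ antidiagonal p.1, f q.1 q.2 p.2 =
      ∑ p ∈ antidiagonal m, ∑ q ∈ antidiagonal p.2, f p.1 q.1 q.2 := by
  rw [sum_sigma', sum_sigma']
  refine sum_nbij' (fun ⟨⟨_i, j⟩, ⟨k, l⟩⟩ ↦ ⟨(k, l + j), (l, j)⟩)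
    (fun ⟨⟨i, _j⟩, ⟨k, l⟩⟩ ↦ ⟨(i + k, l), (i, k)⟩) ?_ ?_ ?_ ?_ ?_ <;>
    aesop (add simp [add_assoc])

theorem sum_antidiagonal_left_comm (m : A) (f : A → A → A → M) :
    ∑ p ∈ antidiagonal m, ∑ q ∈ antidiagonal p.2, f p.1 q.1 q.2 =
      ∑ p ∈ antidiagonal m, ∑ q ∈ antidiagonal p.2, f q.1 p.1 q.2 := by
  rw [← sum_antidiagonal_assoc, ← sum_antidiagonal_assoc m fun a b c => f b a c]
  refine sum_congr rfl fun p _ => ?_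
  rw [← map_swap_antidiagonal, sum_map]
  simp

end TripleSums

namespace Series

variable {ι W : Type*}

section Module

variable [AddCommGroup W] [Module ℝ W]

instance : AddCommGroup (Series ι W) := inferInstanceAs (AddCommGroup ((ι →₀ ℕ) → W))
instance : Module ℝ (Series ι W) := inferInstanceAs (Module ℝ ((ι →₀ ℕ) → W))

@[ext] theorem ext {Z Z' : Series ι W} (h : ∀ m, Z m = Z' m) : Z = Z' := funext h

@[simp] theorem add_apply (Z Z' : Series ι W) (m) : (Z + Z') m = Z m + Z' m := rfl
@[simp] theorem sub_apply (Z Z' : Series ι W) (m) : (Z - Z') m = Z m - Z' m := rfl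
@[simp] theorem neg_apply (Z : Series ι W) (m) : (-Z) m = -Z m := rfl
@[simp] theorem zero_apply (m) : (0 : Series ι W) m = 0 := rfl
@[simp] theorem real_smul_apply (c : ℝ) (Z : Series ι W) (m) : (c • Z) m = c • Z m := rfl

/-- The coefficient of `Z` at `x^m`, as a linear map. -/
def coeff (m : ι →₀ ℕ) : Series ι W →ₗ[ℝ] W where
  toFun Z := Z m
  map_add' _ _ := rfl
  map_smul' _ _ := rfl

theorem sum_apply {α : Type*} (s : Finset α) (Z : α → Series ι W) (m) :
    (∑ a ∈ s, Z a) m = ∑ a ∈ s, Z a m :=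
  map_sum (coeff m) Z s

instance : SMul (FormalFun ι) (Series ι W) where
  smul f Z := fun m => ∑ p ∈ antidiagonal m, MvPowerSeries.coeff p.1 f • Z p.2

theorem smul_apply (f : FormalFun ι) (Z : Series ι W) (m) :
    (f • Z) m = ∑ p ∈ antidiagonal m, MvPowerSeries.coeff p.1 f • Z p.2 := rfl

theorem sum_antidiagonal_eq_zero_left {m : ι →₀ ℕ} {F : (ι →₀ ℕ) × (ι →₀ ℕ) → W}
    (h : ∀ p : (ι →₀ ℕ) × (ι →₀ ℕ), p.1 ≠ 0 → F p = 0) :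
    ∑ p ∈ antidiagonal m, F p = F (0, m) := by
  refine sum_eq_single (0, m) (fun p hp hne => h p fun h0 => hne ?_) (by simp)
  rw [mem_antidiagonal, h0, zero_add] at hp
  exact Prod.ext h0 hp

theorem C_smul (c : ℝ) (Z : Series ι W) : (MvPowerSeries.C c : FormalFun ι) • Z = c • Z := by
  ext m
  rw [smul_apply, sum_antidiagonal_eq_zero_left]
  · simp
  · intro p hp
    simp [MvPowerSeries.coeff_C, hp]

instance : Module (FormalFun ι) (Series ι W) where
  one_smul Z := by simpa using C_smul (1 : ℝ) Z
  mul_smul f f' Z := by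
    ext m
    simp only [smul_apply, MvPowerSeries.coeff_mul, sum_smul, smul_sum, mul_smul]
    exact sum_antidiagonal_assoc m fun a b c =>
      MvPowerSeries.coeff a f • MvPowerSeries.coeff b f' • Z c
  smul_zero f := by ext m; simp [smul_apply]
  smul_add f Z Z' := by ext m; simp [smul_apply, sum_add_distrib]
  add_smul f f' Z := by ext m; simp [smul_apply, sum_add_distrib, add_smul]
  zero_smul Z := by ext m; simp [smul_apply]

instance : IsScalarTower ℝ (FormalFun ι) (Series ι W) where
  smul_assoc c f Z := by
    rw [MvPowerSeries.smul_eq_C_mul, mul_smul, C_smul]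

instance : SMulCommClass ℝ (FormalFun ι) (Series ι W) where
  smul_comm c f Z := by
    rw [← C_smul, ← C_smul, smul_smul, smul_smul, mul_comm]

theorem smul_apply_zero (f : FormalFun ι) (Z : Series ι W) :
    (f • Z) 0 = MvPowerSeries.constantCoeff f • Z 0 := by
  simp [smul_apply]

theorem X_smul_add_single (j : ι) (Z : Series ι W) (m) :
    ((MvPowerSeries.X j : FormalFun ι) • Z) (m + Finsupp.single j 1) = Z m := by
  rw [smul_apply, sum_eq_single (Finsupp.single j 1, m)]
  · simp
  · rintro ⟨a, b⟩ hp hne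
    rw [MvPowerSeries.coeff_X, if_neg, zero_smul]
    rintro rfl
    rw [mem_antidiagonal, add_comm] at hp
    exact hne (Prod.ext rfl (add_right_cancel hp))
  · simp [add_comm]

theorem X_smul_of_eq_zero (j : ι) (Z : Series ι W) (m : ι →₀ ℕ) (h : m j = 0) :
    ((MvPowerSeries.X j : FormalFun ι) • Z) m = 0 := by
  rw [smul_apply]
  refine sum_eq_zero ?_
  rintro ⟨a, b⟩ hp
  rw [MvPowerSeries.coeff_X, if_neg, zero_smul]
  rintro rfl
  rw [mem_antidiagonal] at hp
  simp [← hp] at h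

theorem sub_single_add_single {j : ι} {m : ι →₀ ℕ} (h : m j ≠ 0) :
    m - Finsupp.single j 1 + Finsupp.single j 1 = m :=
  tsub_add_cancel_of_le (Finsupp.single_le_iff.2 (Nat.one_le_iff_ne_zero.2 h))

theorem X_smul_apply (j : ι) (Z : Series ι W) (m) :
    ((MvPowerSeries.X j : FormalFun ι) • Z) m =
      if m j = 0 then 0 else Z (m - Finsupp.single j 1) := by
  split_ifs with h
  · exact X_smul_of_eq_zero j Z m h
  · conv_lhs => rw [← sub_single_add_single h]
    exact X_smul_add_single j Z _

theorem X_smul_injective (j : ι) :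
    Function.Injective fun Z : Series ι W => (MvPowerSeries.X j : FormalFun ι) • Z := by
  intro Z Z' h
  ext m
  rw [← X_smul_add_single j Z, ← X_smul_add_single j Z']
  exact congrFun h _

/-- Constant series. -/
def const : W →ₗ[ℝ] Series ι W where
  toFun w := fun m => if m = 0 then w else 0
  map_add' w w' := funext fun m => by
    change _ = (if m = 0 then w else 0) + (if m = 0 then w' else 0)
    split_ifs <;> simp
  map_smul' c w := funext fun m => by
    change _ = c • (if m = 0 then w else 0)
    split_ifs <;> simp

theorem const_apply (w : W) (m : ι →₀ ℕ) : (const w : Series ι W) m = if m = 0 then w else 0 := rfl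

theorem const_zero (w : W) : (const w : Series ι W) 0 = w := by
  simp [const_apply]

theorem smul_const_apply (f : FormalFun ι) (w : W) (m) :
    (f • (const w : Series ι W)) m = MvPowerSeries.coeff m f • w := by
  rw [smul_apply, sum_eq_single (m, 0)]
  · simp [const_apply]
  · rintro ⟨a, b⟩ hp hne
    rw [const_apply, if_neg, smul_zero]
    rintro rfl
    rw [mem_antidiagonal, add_zero] at hp
    exact hne (Prod.ext hp rfl)
  · simp

/-! #### Derivatives -/

/-- The operator multiplying the coefficient at `x^m` by `m_j`. -/
def theta (j : ι) : Series ι W →ₗ[ℝ] Series ι W where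
  toFun Z := fun m => (m j : ℝ) • Z m
  map_add' _ _ := funext fun _ => smul_add _ _ _
  map_smul' _ _ := funext fun _ => smul_comm _ _ _

theorem theta_apply (j : ι) (Z : Series ι W) (m) : theta j Z m = (m j : ℝ) • Z m := rfl

/-- The Euler operator, multiplying the coefficient at `x^m` by `|m|`. -/
def euler : Series ι W →ₗ[ℝ] Series ι W where
  toFun Z := fun m => (m.degree : ℝ) • Z m
  map_add' _ _ := funext fun _ => smul_add _ _ _
  map_smul' _ _ := funext fun _ => smul_comm _ _ _

theorem euler_apply (Z : Series ι W) (m) : euler Z m = (m.degree : ℝ) • Z m := rfl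

/-- The partial derivative `∂/∂x_j`. -/
def pd (j : ι) : Series ι W →ₗ[ℝ] Series ι W where
  toFun Z := fun m => ((m j : ℝ) + 1) • Z (m + Finsupp.single j 1)
  map_add' _ _ := funext fun _ => smul_add _ _ _
  map_smul' _ _ := funext fun _ => smul_comm _ _ _

theorem pd_apply (j : ι) (Z : Series ι W) (m) :
    pd j Z m = ((m j : ℝ) + 1) • Z (m + Finsupp.single j 1) := rfl

theorem X_smul_pd (j : ι) (Z : Series ι W) :
    (MvPowerSeries.X j : FormalFun ι) • pd j Z = theta j Z := by
  ext m
  rw [X_smul_apply, theta_apply]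
  split_ifs with h
  · simp [h]
  · rw [pd_apply, sub_single_add_single h]
    congr 1
    have : 1 ≤ m j := Nat.one_le_iff_ne_zero.2 h
    simp [Nat.cast_sub this]

theorem X_mul_pderiv_apply (j : ι) (f : FormalFun ι) (m) :
    MvPowerSeries.coeff m (MvPowerSeries.X j * MvPowerSeries.pderiv ℝ j f) =
      (m j : ℝ) * MvPowerSeries.coeff m f := by
  let F : Series ι ℝ := f
  have h := congrArg (fun Z : Series ι ℝ => Z m) (X_smul_pd j F)
  rw [MvPowerSeries.coeff_mul]
  refine Eq.trans (sum_congr rfl fun p _ => ?_) h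
  rw [MvPowerSeries.coeff_pderiv, mul_comm (MvPowerSeries.coeff _ f)]
  rfl

theorem theta_smul (j : ι) (f : FormalFun ι) (Z : Series ι W) :
    theta j (f • Z) = (MvPowerSeries.X j * MvPowerSeries.pderiv ℝ j f) • Z + f • theta j Z := by
  ext m
  rw [add_apply, theta_apply, smul_apply, smul_apply, smul_apply, smul_sum, ← sum_add_distrib]
  refine sum_congr rfl fun p hp => ?_
  rw [mem_antidiagonal] at hp
  rw [X_mul_pderiv_apply, theta_apply, ← hp, Finsupp.add_apply]
  push_cast
  module

/-- `theta` obeys the Leibniz rule because m ↦ m_j is additive; the rule for ∂/∂x_j follows on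
cancelling x_j. `pd_lie` uses the same device. -/
theorem pd_smul (j : ι) (f : FormalFun ι) (Z : Series ι W) :
    pd j (f • Z) = MvPowerSeries.pderiv ℝ j f • Z + f • pd j Z := by
  apply X_smul_injective j
  simp only [smul_add]
  rw [X_smul_pd, theta_smul, mul_smul, smul_comm _ f, X_smul_pd]

theorem euler_pd (j : ι) (Z : Series ι W) : euler (pd j Z) = pd j (euler Z) - pd j Z := by
  ext m
  simp only [euler_apply, pd_apply, sub_apply, map_add, Finsupp.degree_single]
  push_cast
  module

theorem pd_const (j : ι) (w : W) : pd j (const w : Series ι W) = 0 := by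
  ext m
  rw [pd_apply, const_apply, if_neg, smul_zero, zero_apply]
  intro h
  simpa using congrArg (fun n : ι →₀ ℕ => n j) h

theorem pd_X_smul_const [DecidableEq ι] (j k : ι) (w : W) :
    pd j ((MvPowerSeries.X k : FormalFun ι) • (const w : Series ι W)) =
      if j = k then const w else 0 := by
  rw [pd_smul, pd_const, smul_zero, add_zero]
  split_ifs with h
  · subst h; simp
  · rw [MvPowerSeries.pderiv_X_of_ne (Ne.symm h), zero_smul]

theorem euler_const (w : W) : euler (const w : Series ι W) = 0 := by
  ext m
  by_cases h : m = 0 <;> simp [euler_apply, const_apply, h]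

end Module

/-! ### The Lie algebra of series with coefficients in a Lie algebra. -/

section Lie

variable {g : Type*} [LieRing g] [LieAlgebra ℝ g]

instance : Bracket (Series ι g) (Series ι g) where
  bracket Z Z' := fun m => ∑ p ∈ antidiagonal m, ⁅Z p.1, Z' p.2⁆

theorem lie_apply (Z Z' : Series ι g) (m) :
    ⁅Z, Z'⁆ m = ∑ p ∈ antidiagonal m, ⁅Z p.1, Z' p.2⁆ := rfl

instance : LieRing (Series ι g) where
  add_lie Z Z' Z'' := by ext m; simp [lie_apply, sum_add_distrib]
  lie_add Z Z' Z'' := by ext m; simp [lie_apply, sum_add_distrib]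
  lie_self Z := by
    ext m
    have h : ⁅Z, Z⁆ m = -⁅Z, Z⁆ m := by
      conv_lhs => rw [lie_apply, ← map_swap_antidiagonal, sum_map]
      rw [lie_apply, ← sum_neg_distrib]
      exact sum_congr rfl fun p _ => by simp
    exact by
      have h2 : (2 : ℝ) • ⁅Z, Z⁆ m = 0 := by rw [two_smul]; nth_rw 1 [h]; exact neg_add_cancel _
      exact (smul_eq_zero.1 h2).resolve_left two_ne_zero
  leibniz_lie Z Z' Z'' := by
    ext m
    simp only [lie_apply, add_apply, sum_lie, lie_sum]
    rw [sum_antidiagonal_assoc m fun a b c => ⁅⁅Z a, Z' b⁆, Z'' c⁆,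
      sum_antidiagonal_left_comm m fun a b c => ⁅Z' a, ⁅Z b, Z'' c⁆⁆]
    simp only [← sum_add_distrib, ← leibniz_lie]

instance : LieAlgebra (FormalFun ι) (Series ι g) where
  lie_smul f Z Z' := by
    ext m
    simp only [lie_apply, smul_apply, lie_sum, smul_sum, lie_smul]
    exact sum_antidiagonal_left_comm m fun a b c => MvPowerSeries.coeff b f • ⁅Z a, Z' c⁆

instance : LieAlgebra ℝ (Series ι g) where
  lie_smul c Z Z' := by rw [← C_smul, ← C_smul, lie_smul]

theorem lie_apply_zero (Z Z' : Series ι g) : ⁅Z, Z'⁆ 0 = ⁅Z 0, Z' 0⁆ := by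
  simp [lie_apply]

theorem const_lie_apply (X : g) (Z : Series ι g) (m) : ⁅(const X : Series ι g), Z⁆ m = ⁅X, Z m⁆ := by
  rw [lie_apply, sum_antidiagonal_eq_zero_left]
  · simp [const_zero]
  · intro p hp
    simp [const_apply, hp]

theorem theta_lie (j : ι) (Z Z' : Series ι g) :
    theta j ⁅Z, Z'⁆ = ⁅theta j Z, Z'⁆ + ⁅Z, theta j Z'⁆ := by
  ext m
  simp only [add_apply, theta_apply, lie_apply, smul_sum, ← sum_add_distrib]
  refine sum_congr rfl fun p hp => ?_
  rw [mem_antidiagonal] at hp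
  rw [← hp, Finsupp.add_apply, smul_lie, lie_smul, Nat.cast_add, add_smul]

theorem euler_lie (Z Z' : Series ι g) :
    euler ⁅Z, Z'⁆ = ⁅euler Z, Z'⁆ + ⁅Z, euler Z'⁆ := by
  ext m
  simp only [add_apply, euler_apply, lie_apply, smul_sum, ← sum_add_distrib]
  refine sum_congr rfl fun p hp => ?_
  rw [mem_antidiagonal] at hp
  rw [← hp, map_add, smul_lie, lie_smul, Nat.cast_add, add_smul]

theorem pd_lie (j : ι) (Z Z' : Series ι g) :
    pd j ⁅Z, Z'⁆ = ⁅pd j Z, Z'⁆ + ⁅Z, pd j Z'⁆ := by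
  apply X_smul_injective j
  simp only [smul_add]
  rw [← smul_lie, ← lie_smul, X_smul_pd, X_smul_pd, X_smul_pd, theta_lie]

end Lie

end Series

namespace Series

variable {ι W : Type*}

/-! ### The filtration by order of vanishing. -/

section Filtration

variable [AddCommGroup W] [Module ℝ W]

/-- The series without terms of degree less than `N`. -/
def below (ι W : Type*) [AddCommGroup W] [Module ℝ W] (N : ℕ) :
    Submodule (FormalFun ι) (Series ι W) where
  carrier := {Z | ∀ m, m.degree < N → Z m = 0}
  zero_mem' _ _ := rfl
  add_mem' hZ hZ' m hm := by rw [add_apply, hZ m hm, hZ' m hm, add_zero]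
  smul_mem' f Z hZ m hm := by
    rw [smul_apply]
    refine sum_eq_zero fun p hp => ?_
    rw [mem_antidiagonal] at hp
    rw [hZ p.2, smul_zero]
    rw [← hp, map_add] at hm
    omega

theorem below_anti {N N' : ℕ} (h : N ≤ N') : below ι W N' ≤ below ι W N :=
  fun _ hZ m hm => hZ m (hm.trans_le h)

theorem mem_below_zero (Z : Series ι W) : Z ∈ below ι W 0 := fun _ h => absurd h (by omega)

theorem eq_of_sub_mem_below {Z Z' : Series ι W} {N : ℕ} (h : Z - Z' ∈ below ι W N) {m : ι →₀ ℕ}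
    (hm : m.degree < N) : Z m = Z' m :=
  sub_eq_zero.1 (h m hm)

theorem eq_of_forall_sub_mem_below {Z Z' : Series ι W} (h : ∀ N, Z - Z' ∈ below ι W N) : Z = Z' :=
  ext fun m => eq_of_sub_mem_below (h (m.degree + 1)) (Nat.lt_succ_self _)

end Filtration

/-! ### Power series in an operator that raises the order. -/

section Operators

open Polynomial

variable [AddCommGroup W] [Module ℝ W]

/-- The operator `T` raises the order of every series. -/
def RaisesOrder (T : Module.End (FormalFun ι) (Series ι W)) : Prop :=
  ∀ N : ℕ, ∀ Z ∈ below ι W N, T Z ∈ below ι W (N + 1)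

variable {T : Module.End (FormalFun ι) (Series ι W)}

theorem RaisesOrder.pow_mem (hT : RaisesOrder T) (k N : ℕ) {Z : Series ι W}
    (hZ : Z ∈ below ι W N) : (T ^ k) Z ∈ below ι W (N + k) := by
  induction k with
  | zero => simpa using hZ
  | succ k ih => rw [pow_succ', Module.End.mul_apply]; exact hT _ _ ih

theorem RaisesOrder.aeval_mem (hT : RaisesOrder T) (p : ℝ[X]) {N : ℕ} {Z : Series ι W}
    (hZ : Z ∈ below ι W N) : aeval T p Z ∈ below ι W N := by
  rw [aeval_eq_sum_range, LinearMap.sum_apply]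
  refine Submodule.sum_mem _ fun k _ => ?_
  rw [LinearMap.smul_apply, ← C_smul]
  exact Submodule.smul_mem _ _ (below_anti (Nat.le_add_right _ _) (hT.pow_mem k N hZ))

theorem RaisesOrder.aeval_mem_of_dvd (hT : RaisesOrder T) {p : ℝ[X]} {N : ℕ} (hp : X ^ N ∣ p)
    (Z : Series ι W) : aeval T p Z ∈ below ι W N := by
  obtain ⟨q, rfl⟩ := hp
  rw [map_mul, map_pow, aeval_X, Module.End.mul_apply]
  simpa using hT.pow_mem N 0 (mem_below_zero (aeval T q Z))

theorem X_pow_dvd_trunc_sub_trunc (c : PowerSeries ℝ) {N N' : ℕ} (h : N ≤ N') :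
    X ^ N ∣ c.trunc N' - c.trunc N := by
  rw [X_pow_dvd_iff]
  intro d hd
  simp [PowerSeries.coeff_trunc, hd, hd.trans_le h]

theorem X_pow_dvd_trunc_mul_trunc_sub (c d : PowerSeries ℝ) (N : ℕ) :
    X ^ N ∣ c.trunc N * d.trunc N - (c * d).trunc N := by
  rw [X_pow_dvd_iff]
  intro k hk
  rw [coeff_sub, PowerSeries.coeff_trunc, if_pos hk, sub_eq_zero,
    PowerSeries.coeff_mul_eq_coeff_trunc_mul_trunc _ _ hk, ← Polynomial.coeff_coe,
    Polynomial.coe_mul]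

theorem RaisesOrder.trunc_sub_mem (hT : RaisesOrder T) (c : PowerSeries ℝ) {N N' : ℕ} (h : N ≤ N')
    (Z : Series ι W) : aeval T (c.trunc N') Z - aeval T (c.trunc N) Z ∈ below ι W N := by
  rw [← LinearMap.sub_apply, ← map_sub]
  exact hT.aeval_mem_of_dvd (X_pow_dvd_trunc_sub_trunc c h) Z

/-- The values of `∑_h c_h T^h`. -/
def evalFun (T : Module.End (FormalFun ι) (Series ι W)) (c : PowerSeries ℝ) (Z : Series ι W) :
    Series ι W :=
  fun m => aeval T (c.trunc (m.degree + 1)) Z m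

/-- Terms c_h T^h with h ≥ N do not affect degrees below N. Identities for c(T) thus reduce, modulo
order N for each N, to identities for polynomials in T. -/
theorem RaisesOrder.evalFun_sub_mem (hT : RaisesOrder T) (c : PowerSeries ℝ) (Z : Series ι W)
    (N : ℕ) : evalFun T c Z - aeval T (c.trunc N) Z ∈ below ι W N := by
  intro m hm
  rw [sub_apply, sub_eq_zero]
  exact (eq_of_sub_mem_below (hT.trunc_sub_mem c (Nat.succ_le_of_lt hm) Z) (Nat.lt_succ_self _)).symm

/-- The operator `∑_h c_h T^h`, for an operator `T` that raises the order. -/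
def eval (hT : RaisesOrder T) (c : PowerSeries ℝ) : Module.End (FormalFun ι) (Series ι W) where
  toFun := evalFun T c
  map_add' Z Z' := by
    ext m
    simp [evalFun]
  map_smul' f Z := by
    refine eq_of_forall_sub_mem_below fun N => ?_
    have h1 := hT.evalFun_sub_mem c (f • Z) N
    have h2 := (below ι W N).smul_mem f (hT.evalFun_sub_mem c Z N)
    rw [map_smul] at h1
    rw [smul_sub] at h2
    simpa using sub_mem h1 h2

variable (hT : RaisesOrder T)

theorem eval_sub_mem (c : PowerSeries ℝ) (Z : Series ι W) (N : ℕ) :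
    eval hT c Z - aeval T (c.trunc N) Z ∈ below ι W N :=
  hT.evalFun_sub_mem c Z N

theorem eval_mul (c d : PowerSeries ℝ) (Z : Series ι W) :
    eval hT (c * d) Z = eval hT c (eval hT d Z) := by
  refine (eq_of_forall_sub_mem_below fun N => ?_).symm
  -- Writing c_N for the truncation, modulo order N: c(T)d(T)Z ≡ c_N(T)d(T)Z ≡ c_N(T)d_N(T)Z ≡
  -- (cd)_N(T)Z ≡ (cd)(T)Z.
  have h1 := eval_sub_mem hT c (eval hT d Z) N
  have h2 := hT.aeval_mem (c.trunc N) (eval_sub_mem hT d Z N)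
  have h3 := eval_sub_mem hT (c * d) Z N
  have h4 := hT.aeval_mem_of_dvd (X_pow_dvd_trunc_mul_trunc_sub c d N) Z
  rw [map_sub] at h2
  rw [map_sub, map_mul, LinearMap.sub_apply, Module.End.mul_apply] at h4
  have := sub_mem (add_mem (add_mem h1 h2) h4) h3
  convert this using 1
  abel

theorem eval_one (Z : Series ι W) : eval hT 1 Z = Z := by
  ext m
  change aeval T ((1 : PowerSeries ℝ).trunc (m.degree + 1)) Z m = Z m
  rw [PowerSeries.trunc_one]
  simp

theorem eval_X_mul (c : PowerSeries ℝ) (Z : Series ι W) :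
    eval hT (PowerSeries.X * c) Z = T (eval hT c Z) := by
  rw [eval_mul]
  refine eq_of_forall_sub_mem_below fun N => ?_
  have h := eval_sub_mem hT PowerSeries.X (eval hT c Z) (N + 2)
  rw [PowerSeries.trunc_X, aeval_X] at h
  exact below_anti (by omega) h

theorem eval_apply (c : PowerSeries ℝ) (Z : Series ι W) (m : ι →₀ ℕ) :
    eval hT c Z m =
      ∑ k ∈ range (m.degree + 1), PowerSeries.coeff k c • (T ^ k) Z m := by
  change aeval T (c.trunc (m.degree + 1)) Z m = _
  rw [aeval_eq_sum_range' (PowerSeries.natDegree_trunc_lt c m.degree), LinearMap.sum_apply,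
    sum_apply]
  refine sum_congr rfl fun k hk => ?_
  rw [LinearMap.smul_apply, real_smul_apply, PowerSeries.coeff_trunc, if_pos (mem_range.1 hk)]

theorem eval_apply_of_mem_below (c : PowerSeries ℝ) {Z : Series ι W} {N : ℕ}
    (hZ : Z ∈ below ι W N) {m : ι →₀ ℕ} (hm : m.degree ≤ N) :
    eval hT c Z m = PowerSeries.coeff 0 c • Z m := by
  rw [eval_apply, sum_eq_single 0]
  · simp
  · intro k _ hk
    rw [hT.pow_mem k N hZ m (by omega), smul_zero]
  · simp

theorem eval_apply_zero (c : PowerSeries ℝ) (Z : Series ι W) :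
    eval hT c Z 0 = PowerSeries.coeff 0 c • Z 0 :=
  eval_apply_of_mem_below hT c (mem_below_zero Z) (by simp)

end Operators

/-! ### The variable v, and the series e^{-ad v} X and the Maurer-Cartan form. -/

section Variable

variable {g : Type*} [LieRing g] [LieAlgebra ℝ g] [Fintype ι]

/-- The series `∑_j x_j u_j`. -/
def var (u : ι → g) : Series ι g := ∑ j, (MvPowerSeries.X j : FormalFun ι) • (const (u j))

variable (u : ι → g)

theorem var_lie_apply (Z : Series ι g) (m) :
    ⁅var u, Z⁆ m = ∑ j, if m j = 0 then 0 else ⁅u j, Z (m - Finsupp.single j 1)⁆ := by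
  rw [var, sum_lie, sum_apply]
  refine sum_congr rfl fun j _ => ?_
  rw [smul_lie, X_smul_apply, const_lie_apply]

theorem pd_var (j : ι) : pd j (var u) = const (u j) := by
  rw [var, map_sum, sum_eq_single j]
  · rw [pd_X_smul_const, if_pos rfl]
  · intro k _ hk
    rw [pd_X_smul_const, if_neg (Ne.symm hk)]
  · simp

theorem euler_var : euler (var u) = var u := by
  have h : ∀ m : ι →₀ ℕ, m.degree ≠ 1 → var u m = 0 := by
    intro m hm
    rw [var, sum_apply]
    refine sum_eq_zero fun j _ => ?_
    rw [smul_const_apply, MvPowerSeries.coeff_X, if_neg, zero_smul]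
    rintro rfl
    simp at hm
  ext m
  rw [euler_apply]
  by_cases hm : m.degree = 1
  · simp [hm]
  · rw [h m hm, smul_zero]

/-- The operator `ad v`. -/
abbrev adv : Module.End (FormalFun ι) (Series ι g) :=
  LieAlgebra.ad (FormalFun ι) (Series ι g) (var u)

theorem adv_apply (Z : Series ι g) : adv u Z = ⁅var u, Z⁆ := rfl

theorem raisesOrder_adv : RaisesOrder (adv u) := by
  intro N Z hZ m hm
  rw [adv_apply, var_lie_apply]
  refine sum_eq_zero fun j _ => ?_
  split_ifs with h
  · rfl
  · rw [hZ _ _, lie_zero]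
    have := congrArg Finsupp.degree (sub_single_add_single h)
    rw [map_add, Finsupp.degree_single] at this
    omega

/-- This is homogeneity of degree k, in Euler's form: v itself has degree 1 and the Euler operator
is a derivation. -/
theorem euler_adv_pow_const (k : ℕ) (X : g) :
    euler ((adv u ^ k) (const X)) = (k : ℝ) • (adv u ^ k) (const X) := by
  induction k with
  | zero => simp [euler_const]
  | succ k ih =>
    rw [pow_succ', Module.End.mul_apply, adv_apply, euler_lie, euler_var, ih, lie_smul]
    push_cast
    module

theorem adv_pow_const_apply_of_ne (k : ℕ) (X : g) {m : ι →₀ ℕ} (h : m.degree ≠ k) :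
    (adv u ^ k) (const X) m = 0 := by
  have h1 := congrArg (fun Z => Z m) (euler_adv_pow_const u k X)
  simp only [euler_apply, real_smul_apply] at h1
  rw [← sub_eq_zero, ← sub_smul, smul_eq_zero, sub_eq_zero] at h1
  exact h1.resolve_left (by exact_mod_cast h)

theorem eval_const_apply (c : PowerSeries ℝ) (X : g) (m : ι →₀ ℕ) :
    eval (raisesOrder_adv u) c (const X) m =
      PowerSeries.coeff m.degree c • (adv u ^ m.degree) (const X) m := by
  rw [eval_apply, sum_eq_single m.degree]
  · intro k _ hk
    rw [adv_pow_const_apply_of_ne u k X (Ne.symm hk), smul_zero]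
  · simp

theorem euler_eval_const (c : PowerSeries ℝ) (X : g) :
    euler (eval (raisesOrder_adv u) c (const X)) =
      eval (raisesOrder_adv u) (PowerSeries.mk fun n => n * PowerSeries.coeff n c) (const X) := by
  ext m
  rw [euler_apply, eval_const_apply, eval_const_apply, smul_smul, PowerSeries.coeff_mk]

/-- Uniqueness for a linear equation along the rays through 0: in degree d it reads (d + k) Z_d =
-[v, Z_{d-1}], so Z_d is determined by the lower part unless d = k = 0, where an initial value is
needed. The exponential identities below are proved by checking that the difference of the two sides
satisfies such an equation. -/
theorem eq_zero_of_euler_eq (k : ℕ) {Z : Series ι g} (h : euler Z + (k : ℝ) • Z = -⁅var u, Z⁆)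
    (h0 : k = 0 → Z 0 = 0) : Z = 0 := by
  have key : ∀ N, Z ∈ below ι g N := by
    intro N
    induction N with
    | zero => exact mem_below_zero Z
    | succ N ih =>
      intro m hm
      rcases Nat.lt_succ_iff_lt_or_eq.1 hm with hm' | hm'
      · exact ih m hm'
      · have h1 := congrArg (fun Z => Z m) h
        have h2 : ⁅var u, Z⁆ m = 0 := raisesOrder_adv u N Z ih m hm
        simp only [add_apply, euler_apply, real_smul_apply, neg_apply, h2, neg_zero] at h1
        rw [← add_smul, smul_eq_zero] at h1
        rcases h1 with h1 | h1
        · have h3 : m.degree + k = 0 := by exact_mod_cast h1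
          have h4 : m = 0 := (Finsupp.degree_eq_zero_iff m).1 (by omega)
          rw [h4]
          exact h0 (by omega)
        · exact h1
  exact ext fun m => key (m.degree + 1) m (Nat.lt_succ_self _)

/-- The series `exp(-v)_* X = ∑_h (-1)^h / h! (ad v)^h X`. -/
def expAd (X : g) : Series ι g :=
  eval (raisesOrder_adv u) (PowerSeries.evalNegHom (PowerSeries.exp ℝ)) (const X)

/-- The power series `(1 - exp (-t)) / t`. -/
def oneSubExpDiv : PowerSeries ℝ := PowerSeries.mk fun n : ℕ => (-1 : ℝ) ^ n / ((n + 1).factorial : ℝ)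

/-- The component along `∂/∂x_j` of the Maurer-Cartan form `exp(-v) d exp(v)`. -/
def mc (j : ι) : Series ι g := eval (raisesOrder_adv u) oneSubExpDiv (const (u j))

theorem coeff_exp_neg (n : ℕ) :
    PowerSeries.coeff n (PowerSeries.evalNegHom (PowerSeries.exp ℝ)) =
      (-1 : ℝ) ^ n / (n.factorial : ℝ) := by
  simp [PowerSeries.evalNegHom, PowerSeries.coeff_rescale, PowerSeries.coeff_exp, div_eq_mul_inv]

theorem euler_expAd (X : g) : euler (expAd u X) = -⁅var u, expAd u X⁆ := by
  rw [expAd, euler_eval_const, ← adv_apply, ← eval_X_mul]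
  ext m
  rw [neg_apply, eval_const_apply, eval_const_apply, ← neg_smul]
  congr 1
  rw [PowerSeries.coeff_mk, coeff_exp_neg]
  cases m.degree with
  | zero => simp
  | succ n =>
    rw [PowerSeries.coeff_succ_X_mul, coeff_exp_neg, Nat.factorial_succ]
    have : ((n : ℝ) + 1) ≠ 0 := by positivity
    have : (n.factorial : ℝ) ≠ 0 := by positivity
    push_cast
    field_simp
    ring

theorem euler_mc (j : ι) : euler (mc u j) + mc u j = const (u j) - ⁅var u, mc u j⁆ := by
  have h1 : (const (u j) : Series ι g) = eval (raisesOrder_adv u) 1 (const (u j)) :=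
    (eval_one _ _).symm
  rw [mc, euler_eval_const, ← adv_apply, ← eval_X_mul]
  nth_rw 3 [h1]
  ext m
  rw [sub_apply, add_apply, eval_const_apply, eval_const_apply, eval_const_apply,
    eval_const_apply, ← add_smul, ← sub_smul]
  congr 1
  rw [PowerSeries.coeff_mk]
  cases m.degree with
  | zero => simp [oneSubExpDiv]
  | succ n =>
    rw [PowerSeries.coeff_succ_X_mul, PowerSeries.coeff_one, if_neg (by omega)]
    simp only [oneSubExpDiv, PowerSeries.coeff_mk]
    rw [Nat.factorial_succ (n + 1)]
    have : ((n : ℝ) + 1 + 1) ≠ 0 := by positivity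
    have : ((n + 1).factorial : ℝ) ≠ 0 := by positivity
    push_cast
    field_simp
    ring

theorem expAd_zero (X : g) : expAd u X 0 = X := by
  rw [expAd, eval_apply_zero, coeff_exp_neg, const_zero]
  simp

theorem mc_zero (j : ι) : mc u j 0 = u j := by
  rw [mc, eval_apply_zero, const_zero]
  simp [oneSubExpDiv]

theorem lie_expAd (X Y : g) : ⁅expAd u X, expAd u Y⁆ = expAd u ⁅X, Y⁆ := by
  rw [← sub_eq_zero]
  refine eq_zero_of_euler_eq u 0 ?_ ?_
  · rw [map_sub, euler_lie, euler_expAd, euler_expAd, euler_expAd, lie_sub, leibniz_lie (var u)]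
    simp only [neg_lie, lie_neg, Nat.cast_zero, zero_smul]
    abel
  · intro _
    rw [sub_apply, lie_apply_zero, expAd_zero, expAd_zero, expAd_zero, sub_self]

/-- The constant is k = 1 because ∂/∂x_j lowers the degree by one; in the curvature identity
`pd_mc_sub` the form itself contributes another 1. -/
theorem pd_expAd (j : ι) (X : g) : pd j (expAd u X) = -⁅mc u j, expAd u X⁆ := by
  rw [eq_neg_iff_add_eq_zero]
  refine eq_zero_of_euler_eq u 1 ?_ (by simp)
  have h1 := euler_mc u j
  rw [← eq_sub_iff_add_eq] at h1
  rw [map_add, euler_pd, euler_lie, euler_expAd, h1, map_neg, pd_lie, pd_var, lie_add,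
    leibniz_lie (var u)]
  simp only [sub_lie, lie_neg, Nat.cast_one, one_smul]
  abel

theorem pd_mc_sub (j k : ι) : pd j (mc u k) - pd k (mc u j) + ⁅mc u j, mc u k⁆ = 0 := by
  refine eq_zero_of_euler_eq u 2 ?_ (by simp)
  have h1 := fun j => eq_sub_iff_add_eq.2 (euler_mc u j)
  rw [map_add, map_sub, euler_pd, euler_pd, euler_lie, h1, h1]
  simp only [map_sub, pd_lie, pd_var, pd_const, lie_add, lie_sub, sub_lie,
    leibniz_lie (var u) (mc u j)]
  rw [← lie_skew (mc u j) (const (u k))]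
  push_cast
  module

end Variable

end Series

/-! ### Formal vector fields in coordinates. -/

section Derivations

variable {ι : Type*} [Fintype ι]

theorem coeff_X_mul (j : ι) (f : FormalFun ι) (m : ι →₀ ℕ) :
    MvPowerSeries.coeff m (MvPowerSeries.X j * f) =
      if m j = 0 then 0 else MvPowerSeries.coeff (m - Finsupp.single j 1) f := by
  rw [MvPowerSeries.coeff_mul]
  exact Series.X_smul_apply (W := ℝ) j f m

theorem degree_eq_sum (m : ι →₀ ℕ) : m.degree = ∑ j, m j :=
  Finset.sum_subset (Finset.subset_univ _) (by simp)

theorem exists_eq_C_add_sum_X_mul (f : FormalFun ι) :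
    ∃ k : ι → FormalFun ι,
      f = MvPowerSeries.C (MvPowerSeries.constantCoeff f) + ∑ j, MvPowerSeries.X j * k j := by
  -- Each term of degree |m| > 0 is shared among the variables in the proportions m_j / |m|, which
  -- add up to 1.
  let k : ι → FormalFun ι := fun j m => (((m j : ℝ) + 1) / (m.degree + 1)) *
    MvPowerSeries.coeff (m + Finsupp.single j 1) f
  refine ⟨k, ?_⟩
  ext m
  rw [map_add, map_sum]
  by_cases hm : m = 0
  · subst hm
    simp
  · have hd : (m.degree : ℝ) ≠ 0 := by
      exact_mod_cast fun h => hm ((Finsupp.degree_eq_zero_iff m).1 h)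
    have h : ∀ j, MvPowerSeries.coeff m (MvPowerSeries.X j * k j) =
        (m j : ℝ) * (MvPowerSeries.coeff m f / m.degree) := by
      intro j
      rw [coeff_X_mul]
      split_ifs with hj
      · simp [hj]
      · obtain ⟨n, rfl⟩ : ∃ n, n + Finsupp.single j 1 = m :=
          ⟨_, Series.sub_single_add_single hj⟩
        rw [add_tsub_cancel_right, MvPowerSeries.coeff_apply (k j), map_add,
          Finsupp.degree_single, Finsupp.add_apply, Finsupp.single_eq_same]
        simp only [k]
        push_cast
        ring
    rw [sum_congr rfl fun j _ => h j, ← sum_mul, ← Nat.cast_sum, ← degree_eq_sum,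
      mul_div_cancel₀ _ hd, MvPowerSeries.coeff_C_of_ne_zero hm, zero_add]

/-- No continuity of Θ is needed: if f = f(0) + ∑ x_j k_j, then Θ f = ∑ x_j Θ(k_j), and iterating
pushes Θ f into every order. -/
theorem formalVF_eq_zero {Θ : FormalVF ι} (h : ∀ j, Θ (MvPowerSeries.X j) = 0) : Θ = 0 := by
  have key : ∀ (N : ℕ) (f : FormalFun ι) (m : ι →₀ ℕ), m.degree < N →
      MvPowerSeries.coeff m (Θ f) = 0 := by
    intro N
    induction N with
    | zero => intro f m hm; omega
    | succ N ih =>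
      intro f m hm
      obtain ⟨k, hk⟩ := exists_eq_C_add_sum_X_mul f
      have hC : Θ (MvPowerSeries.C (MvPowerSeries.constantCoeff f)) = 0 :=
        Θ.map_algebraMap (MvPowerSeries.constantCoeff f)
      rw [hk, map_add, hC, zero_add, map_sum, map_sum]
      refine sum_eq_zero fun j _ => ?_
      rw [Derivation.leibniz, h, smul_zero, add_zero, smul_eq_mul, coeff_X_mul]
      split_ifs with hj
      · rfl
      · refine ih _ _ ?_
        have := congrArg Finsupp.degree (Series.sub_single_add_single hj)
        rw [map_add, Finsupp.degree_single] at this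
        omega
  ext f m
  exact key (m.degree + 1) f m (Nat.lt_succ_self _)

theorem formalVF_ext {Θ Ξ : FormalVF ι}
    (h : ∀ j, Θ (MvPowerSeries.X j) = Ξ (MvPowerSeries.X j)) : Θ = Ξ :=
  sub_eq_zero.1 (formalVF_eq_zero fun j => by rw [Derivation.sub_apply, h, sub_self])

theorem sum_smul_pderiv_X (a : ι → FormalFun ι) (k : ι) :
    (∑ j, a j • MvPowerSeries.pderiv ℝ j : FormalVF ι) (MvPowerSeries.X k) = a k := by
  rw [← Derivation.coeFnAddMonoidHom_apply, map_sum, Finset.sum_apply, sum_eq_single k]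
  · simp
  · intro j _ hj
    simp [MvPowerSeries.pderiv_X_of_ne (Ne.symm hj)]
  · simp

theorem eq_sum_smul_pderiv (Θ : FormalVF ι) :
    Θ = ∑ j, Θ (MvPowerSeries.X j) • MvPowerSeries.pderiv ℝ j :=
  formalVF_ext fun k => (sum_smul_pderiv_X (fun j => Θ (MvPowerSeries.X j)) k).symm

theorem formalVF_apply (Θ : FormalVF ι) (f : FormalFun ι) :
    Θ f = ∑ j, Θ (MvPowerSeries.X j) * MvPowerSeries.pderiv ℝ j f := by
  conv_lhs => rw [eq_sum_smul_pderiv Θ]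
  rw [← Derivation.coeFnAddMonoidHom_apply, map_sum, Finset.sum_apply]
  rfl

theorem mem_der₀_iff {Θ : FormalVF ι} :
    Θ ∈ der₀ ι ↔ ∀ j, MvPowerSeries.constantCoeff (Θ (MvPowerSeries.X j)) = 0 := by
  constructor
  · intro h j
    refine Submodule.smul_induction_on h (fun f hf Ξ _ => ?_) fun Ξ Ξ' h h' => ?_
    · rw [formalFun₀, RingHom.mem_ker] at hf
      simp [hf]
    · simp [h, h']
  · intro h
    rw [eq_sum_smul_pderiv Θ]
    exact Submodule.sum_mem _ fun j _ => Submodule.smul_mem_smul (h j) trivial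

end Derivations

/-! ### Lie derivatives and the Maurer-Cartan equation. -/

namespace Series

variable {ι : Type*} [Fintype ι]

section Lie

variable {W : Type*} [AddCommGroup W] [Module ℝ W]

/-- The Lie derivative of a series along a formal vector field. -/
def der (Θ : FormalVF ι) : Series ι W →ₗ[ℝ] Series ι W where
  toFun Z := ∑ j, Θ (MvPowerSeries.X j) • pd j Z
  map_add' Z Z' := by simp [sum_add_distrib]
  map_smul' c Z := by
    simp only [map_smul, smul_sum, RingHom.id_apply]
    exact sum_congr rfl fun j _ => smul_comm _ _ _

theorem der_apply (Θ : FormalVF ι) (Z : Series ι W) :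
    der Θ Z = ∑ j, Θ (MvPowerSeries.X j) • pd j Z := rfl

theorem der_smul (Θ : FormalVF ι) (f : FormalFun ι) (Z : Series ι W) :
    der Θ (f • Z) = Θ f • Z + f • der Θ Z := by
  simp only [der_apply, pd_smul, smul_add, sum_add_distrib]
  rw [formalVF_apply Θ f, sum_smul, smul_sum]
  congr 1
  · exact sum_congr rfl fun j _ => (mul_smul _ _ _).symm
  · exact sum_congr rfl fun j _ => smul_comm _ _ _

theorem der_apply_zero {Θ : FormalVF ι} (h : Θ ∈ der₀ ι) (Z : Series ι W) : der Θ Z 0 = 0 := by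
  rw [der_apply, sum_apply]
  refine sum_eq_zero fun j _ => ?_
  rw [smul_apply_zero, mem_der₀_iff.1 h, zero_smul]

/-- The series with coefficients in a subspace. -/
def valuesIn (ι : Type*) (l : Submodule ℝ W) : Submodule (FormalFun ι) (Series ι W) where
  carrier := {Z | ∀ m, Z m ∈ l}
  zero_mem' _ := l.zero_mem
  add_mem' hZ hZ' m := l.add_mem (hZ m) (hZ' m)
  smul_mem' f Z hZ m := by
    rw [smul_apply]
    exact l.sum_mem fun p _ => l.smul_mem _ (hZ _)

theorem valuesIn_mono {l l' : Submodule ℝ W} (h : l ≤ l') : valuesIn ι l ≤ valuesIn ι l' :=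
  fun _ hZ m => h (hZ m)

theorem const_mem_valuesIn {l : Submodule ℝ W} {w : W} (h : w ∈ l) :
    (const w : Series ι W) ∈ valuesIn ι l := by
  intro m
  rw [const_apply]
  split_ifs
  · exact h
  · exact l.zero_mem

theorem der_mem_valuesIn (Θ : FormalVF ι) {l : Submodule ℝ W} {Z : Series ι W}
    (hZ : Z ∈ valuesIn ι l) : der Θ Z ∈ valuesIn ι l := by
  rw [der_apply]
  exact Submodule.sum_mem _ fun j _ => Submodule.smul_mem _ _ fun m => l.smul_mem _ (hZ _)

variable {g : Type*} [LieRing g] [LieAlgebra ℝ g]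

theorem lie_mem_valuesIn {l l' l'' : Submodule ℝ g} (h : ∀ X ∈ l, ∀ Y ∈ l', ⁅X, Y⁆ ∈ l'')
    {Z Z' : Series ι g} (hZ : Z ∈ valuesIn ι l) (hZ' : Z' ∈ valuesIn ι l') :
    ⁅Z, Z'⁆ ∈ valuesIn ι l'' := by
  intro m
  rw [lie_apply]
  exact Submodule.sum_mem _ fun p _ => h _ (hZ _) _ (hZ' _)

variable (u : ι → g)

/-- The value of the Maurer-Cartan form `exp(-v) d exp(v)` on a formal vector field. -/
def mcForm : FormalVF ι →ₗ[FormalFun ι] Series ι g where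
  toFun Θ := ∑ j, Θ (MvPowerSeries.X j) • mc u j
  map_add' Θ Ξ := by simp [add_smul, sum_add_distrib]
  map_smul' f Θ := by simp [smul_sum, mul_smul]

theorem mcForm_apply (Θ : FormalVF ι) : mcForm u Θ = ∑ j, Θ (MvPowerSeries.X j) • mc u j := rfl

theorem der_expAd (Θ : FormalVF ι) (X : g) : der Θ (expAd u X) = -⁅mcForm u Θ, expAd u X⁆ := by
  rw [der_apply, mcForm_apply, sum_lie, ← sum_neg_distrib]
  exact sum_congr rfl fun j _ => by rw [pd_expAd, smul_lie, smul_neg]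

/-- The Maurer-Cartan equation. -/
theorem mcForm_lie (Θ Ξ : FormalVF ι) :
    mcForm u ⁅Θ, Ξ⁆ = der Θ (mcForm u Ξ) - der Ξ (mcForm u Θ) + ⁅mcForm u Θ, mcForm u Ξ⁆ := by
  -- Differentiating the components of the field gives ω([Θ, Ξ]) after antisymmetrization;
  -- differentiating ω gives dω(Θ, Ξ), which cancels the bracket term by `pd_mc_sub`.
  have h1 : ∀ Θ Ξ : FormalVF ι, der Θ (mcForm u Ξ) =
      ∑ k, Θ (Ξ (MvPowerSeries.X k)) • mc u k +
        ∑ j, ∑ k, (Θ (MvPowerSeries.X j) * Ξ (MvPowerSeries.X k)) • pd j (mc u k) := by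
    intro Θ Ξ
    rw [sum_comm, mcForm_apply, map_sum, ← sum_add_distrib]
    refine sum_congr rfl fun k _ => ?_
    rw [der_smul, der_apply, smul_sum]
    congr 1
    refine sum_congr rfl fun j _ => ?_
    rw [mul_smul, smul_comm]
  have h2 : ⁅mcForm u Θ, mcForm u Ξ⁆ = ∑ j, ∑ k,
      (Θ (MvPowerSeries.X j) * Ξ (MvPowerSeries.X k)) • (pd k (mc u j) - pd j (mc u k)) := by
    rw [mcForm_apply, mcForm_apply, sum_lie]
    refine sum_congr rfl fun j _ => ?_
    rw [lie_sum]
    refine sum_congr rfl fun k _ => ?_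
    rw [smul_lie, lie_smul, ← mul_smul]
    congr 1
    rw [← sub_eq_zero, ← pd_mc_sub u j k]
    abel
  have h3 : mcForm u ⁅Θ, Ξ⁆ = ∑ k, Θ (Ξ (MvPowerSeries.X k)) • mc u k -
      ∑ k, Ξ (Θ (MvPowerSeries.X k)) • mc u k := by
    rw [mcForm_apply, ← sum_sub_distrib]
    exact sum_congr rfl fun k _ => by rw [Derivation.commutator_apply, sub_smul]
  have h4 : ∑ j, ∑ k, (Ξ (MvPowerSeries.X j) * Θ (MvPowerSeries.X k)) • pd j (mc u k) =
      ∑ j, ∑ k, (Θ (MvPowerSeries.X j) * Ξ (MvPowerSeries.X k)) • pd k (mc u j) := by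
    rw [sum_comm]
    exact sum_congr rfl fun j _ => sum_congr rfl fun k _ => by rw [mul_comm]
  rw [h3, h1, h1, h2, h4]
  simp only [smul_sub, sum_sub_distrib]
  abel

end Lie

end Series

/-! ### The series `∑ b_h t^h` -/

theorem mk_b_eq : PowerSeries.mk b = Series.oneSubExpDiv⁻¹ := by
  ext n
  simp [b, Series.oneSubExpDiv]

theorem oneSubExpDiv_mul_mk_b : Series.oneSubExpDiv * PowerSeries.mk b = 1 := by
  rw [mk_b_eq]
  exact PowerSeries.mul_inv_cancel _ (by simp [Series.oneSubExpDiv])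

theorem X_mul_oneSubExpDiv : PowerSeries.X * Series.oneSubExpDiv =
    1 - PowerSeries.evalNegHom (PowerSeries.exp ℝ) := by
  have h := congrArg (· * Series.oneSubExpDiv) mk_b_mul
  rw [← h, mul_right_comm, mul_comm (PowerSeries.mk b), oneSubExpDiv_mul_mk_b, one_mul]

theorem mk_neg_one_pow_mul_b :
    PowerSeries.mk (fun h => (-1 : ℝ) ^ h * b h) = PowerSeries.evalNegHom (PowerSeries.mk b) := by
  ext n
  simp [PowerSeries.evalNegHom, PowerSeries.coeff_rescale]

/-- With B(t) = ∑ b_h t^h, the substitution t ↦ -t gives B(-t)(1 - e^t) = -t. After multiplication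
by the nonzero series t(1 - e^t), both sides become t(e^{-t} - 1). -/
theorem oneSubExpDiv_mul_mk_neg_one_pow_mul_b :
    Series.oneSubExpDiv * PowerSeries.mk (fun h => (-1 : ℝ) ^ h * b h) =
      PowerSeries.evalNegHom (PowerSeries.exp ℝ) := by
  have h1 := congrArg PowerSeries.evalNegHom mk_b_mul
  have h2 : PowerSeries.evalNegHom (PowerSeries.evalNegHom (PowerSeries.exp ℝ)) =
      PowerSeries.exp ℝ := by
    ext n
    simp only [PowerSeries.evalNegHom, PowerSeries.coeff_rescale, ← mul_assoc, ← mul_pow]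
    simp
  have h3 : PowerSeries.evalNegHom (PowerSeries.X : PowerSeries ℝ) = -PowerSeries.X := by
    ext n
    simp only [PowerSeries.evalNegHom, PowerSeries.coeff_rescale, map_neg, PowerSeries.coeff_X]
    split_ifs with h
    · simp [h]
    · simp
  have h4 := PowerSeries.exp_mul_exp_neg_eq_one (A := ℝ)
  rw [map_mul, map_sub, map_one, h2, h3] at h1
  have h5 : (PowerSeries.X * (1 - PowerSeries.exp ℝ) : PowerSeries ℝ) ≠ 0 := by
    intro h
    have := congrArg (PowerSeries.coeff 2) h
    rw [show 2 = 1 + 1 from rfl, PowerSeries.coeff_succ_X_mul] at this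
    simp [PowerSeries.coeff_exp, PowerSeries.coeff_one] at this
  refine mul_right_cancel₀ h5 ?_
  rw [mk_neg_one_pow_mul_b]
  linear_combination (PowerSeries.X * Series.oneSubExpDiv) * h1 -
    PowerSeries.X * X_mul_oneSubExpDiv + PowerSeries.X * h4

/-! ### The defining equation of R*_X and L*_X in terms of the Maurer-Cartan form. -/

section Fields

open Series

variable {g : Type*} [LieRing g] [LieAlgebra ℝ g] {i : LieSubalgebra ℝ g} {V : Submodule ℝ g}
  {ι : Type*} [Fintype ι]

/-- The basis of `V`, as a family in `g`. -/
abbrev frame (e : Module.Basis ι ℝ V) : ι → g := fun j => (e j : g)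

theorem sub_proj_mem (hV : IsCompl V i.toSubmodule) (Y : g) : Y - (proj hV Y : g) ∈ i := by
  have h : Y - (proj hV Y : g) ∈ i.toSubmodule := by
    rw [← Submodule.projectionOnto_apply_eq_zero_iff hV, map_sub,
      Submodule.projectionOnto_apply_left]
    exact sub_self _
  exact h

theorem proj_eq_zero_iff (hV : IsCompl V i.toSubmodule) (Y : g) : proj hV Y = 0 ↔ Y ∈ i :=
  Submodule.projectionOnto_apply_eq_zero_iff hV

theorem proj_coe (hV : IsCompl V i.toSubmodule) (Y : V) : proj hV (Y : g) = Y :=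
  Submodule.projectionOnto_apply_left hV Y

theorem constMap_eq (X : g) : (constMap X : FormalMap ι g) = (const X : Series ι g) := by
  funext m
  rw [const_apply, constMap]
  congr

theorem adVar_eq (e : Module.Basis ι ℝ V) (Z : Series ι g) :
    adVar e Z = adv (frame e) Z :=
  funext fun m => (var_lie_apply (frame e) Z m).symm

theorem adVar_iterate_eq (e : Module.Basis ι ℝ V) (k : ℕ) (Z : Series ι g) :
    (adVar e)^[k] Z = (adv (frame e) ^ k) Z := by
  induction k with
  | zero => rfl
  | succ k ih =>
    rw [pow_succ', Module.End.mul_apply, ← ih]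
    exact (Function.iterate_succ_apply' _ _ _).trans (adVar_eq e _)

/-- Allows each H_h of the recursion to be replaced by the full series ∑ H_h, only its coefficients
in degree h being used; homogeneity of H_h need not be shown. -/
theorem adv_pow_apply_congr (u : ι → g) (k : ℕ) {Z Z' : Series ι g} {m : ι →₀ ℕ}
    (h : ∀ m' : ι →₀ ℕ, m'.degree + k = m.degree → Z m' = Z' m') :
    (adv u ^ k) Z m = (adv u ^ k) Z' m := by
  induction k generalizing m with
  | zero => exact h m rfl
  | succ k ih =>
    rw [pow_succ', Module.End.mul_apply, Module.End.mul_apply, adv_apply, adv_apply,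
      var_lie_apply, var_lie_apply]
    refine sum_congr rfl fun j _ => ?_
    split_ifs with hj
    · rfl
    · have hd := congrArg Finsupp.degree (sub_single_add_single hj)
      rw [map_add, Finsupp.degree_single] at hd
      rw [ih fun m' hm' => h m' (by omega)]

variable (hV : IsCompl V i.toSubmodule) (e : Module.Basis ι ℝ V)

/-- The series `∑_h H_h` in `𝓕 ⊗ i`. -/
def isotropySeries (c : ℕ → ℝ) (X : g) : Series ι g :=
  fun m => isotropyPart hV e c X m.degree m

theorem isotropySeries_mem (c : ℕ → ℝ) (X : g) :
    isotropySeries hV e c X ∈ valuesIn ι i.toSubmodule := by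
  intro m
  rw [isotropySeries, isotropyPart]
  exact sub_proj_mem hV _

/-- A series in `𝓕 ⊗ V` as a series in `𝓕 ⊗ g`. -/
def incl (a : FormalMap ι V) : Series ι g := fun m => (a m : g)

theorem incl_eq_sum (a : FormalMap ι V) :
    incl a = ∑ j, coord e a j • (const (e j : g) : Series ι g) := by
  ext m
  rw [Series.sum_apply]
  simp only [smul_const_apply]
  change (a m : g) = ∑ j, e.repr (a m) j • (e j : g)
  have h := congrArg V.subtype (e.sum_repr (a m))
  simp only [map_sum, map_smul] at h
  exact h.symm

theorem fieldSeries_add_isotropySeries (c : ℕ → ℝ) (X : g) (m : ι →₀ ℕ) :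
    incl (fieldSeries hV e c X) m + isotropySeries hV e c X m =
      rhs e c X m.degree (fun k _ => isotropyPart hV e c X k) m := by
  rw [isotropySeries, isotropyPart]
  exact add_sub_cancel _ _

theorem b_zero : b 0 = 1 := by
  simp [b]

/-- The recursion summed over all degrees. The term r = 0 of the second sum is H itself, as b_0 = 1;
`rhs` carries the terms with r > 0 to the other side. -/
theorem eval_const_eq (c : ℕ → ℝ) (X : g) :
    eval (raisesOrder_adv (frame e)) (PowerSeries.mk c) (const X) =
      incl (fieldSeries hV e c X) +
        eval (raisesOrder_adv (frame e)) (PowerSeries.mk b) (isotropySeries hV e c X) := by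
  ext m
  have h1 := fieldSeries_add_isotropySeries hV e c X m
  rw [Series.add_apply, eval_const_apply, eval_apply, sum_range_succ']
  simp only [PowerSeries.coeff_mk, pow_zero, Module.End.one_apply, b_zero, one_smul]
  rw [add_left_comm, h1, rhs]
  have h2 : ∀ r : Fin m.degree,
      ((adVar e)^[(r : ℕ) + 1] (isotropyPart hV e c X (m.degree - 1 - r))) m =
        ((adv (frame e)) ^ ((r : ℕ) + 1)) (isotropySeries hV e c X) m := by
    intro r
    refine (congrFun (adVar_iterate_eq e _ _) m).trans (adv_pow_apply_congr _ _ fun m' hm' => ?_)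
    rw [isotropySeries, show m'.degree = m.degree - 1 - r by omega]
  have h3 : ((adVar e)^[m.degree] (constMap X)) m = ((adv (frame e)) ^ m.degree) (const X) m := by
    rw [constMap_eq]
    exact congrFun (adVar_iterate_eq e _ _) m
  rw [Pi.sub_apply, Pi.smul_apply, h3, Finset.sum_apply]
  simp only [Pi.smul_apply, h2]
  rw [← Fin.sum_univ_eq_sum_range
    fun k => b (k + 1) • ((adv (frame e)) ^ (k + 1)) (isotropySeries hV e c X) m]
  abel

theorem toDer_X (a : FormalMap ι V) (j : ι) : toDer e a (MvPowerSeries.X j) = coord e a j :=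
  sum_smul_pderiv_X (coord e a) j

theorem mcForm_eq_eval (Θ : FormalVF ι) : mcForm (frame e) Θ =
    eval (raisesOrder_adv (frame e)) oneSubExpDiv
      (∑ j, Θ (MvPowerSeries.X j) • (const (e j : g) : Series ι g)) := by
  rw [map_sum, mcForm_apply]
  exact sum_congr rfl fun j _ => by rw [map_smul, mc]

/-- (1 - e^{-t})/t is inverse to ∑ b_h t^h, so applying it to the defining equation leaves H bare,
and ω of the field is what it makes of the V-part. -/
theorem mcForm_toDer (c : ℕ → ℝ) (X : g) :
    mcForm (frame e) (toDer e (fieldSeries hV e c X)) =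
      eval (raisesOrder_adv (frame e)) (oneSubExpDiv * PowerSeries.mk c) (const X) -
        isotropySeries hV e c X := by
  rw [eval_mul, eval_const_eq hV e c X, map_add, ← eval_mul, oneSubExpDiv_mul_mk_b, eval_one,
    add_sub_cancel_right, mcForm_eq_eval, incl_eq_sum e]
  simp only [toDer_X]

theorem mcForm_Rstar (X : g) : mcForm (frame e) (Rstar hV e X) = expAd (frame e) X -
    isotropySeries hV e (fun h => (-1) ^ h * b h) X := by
  rw [Rstar, mcForm_toDer, oneSubExpDiv_mul_mk_neg_one_pow_mul_b, expAd]

theorem mcForm_Lstar (X : g) : mcForm (frame e) (Lstar hV e X) = const X -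
    isotropySeries hV e b X := by
  rw [Lstar, mcForm_toDer, oneSubExpDiv_mul_mk_b, eval_one]

theorem valueAtZero_apply (Θ : FormalVF ι) : valueAtZero e Θ =
    ∑ j, MvPowerSeries.constantCoeff (Θ (MvPowerSeries.X j)) • e j := rfl

theorem mcForm_apply_zero (Θ : FormalVF ι) : mcForm (frame e) Θ 0 = valueAtZero e Θ := by
  rw [mcForm_apply, Series.sum_apply, valueAtZero_apply]
  simp [smul_apply_zero, mc_zero]

theorem valueAtZero_eq_zero_iff {Θ : FormalVF ι} : valueAtZero e Θ = 0 ↔ Θ ∈ der₀ ι := by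
  rw [mem_der₀_iff, valueAtZero_apply]
  exact ⟨fun h => Fintype.linearIndependent_iff.1 e.linearIndependent _ h,
    fun h => by simp [h]⟩

/-- (1 - e^{-t})/t has constant term 1, so the lowest-degree part of ω(Θ) is that of Θ. It has
values in V, hence is zero if it also lies in `i`. -/
theorem eq_zero_of_mcForm_mem (hV : IsCompl V i.toSubmodule) {Θ : FormalVF ι}
    (h : mcForm (frame e) Θ ∈ valuesIn ι i.toSubmodule) : Θ = 0 := by
  set Z : Series ι g := ∑ j, Θ (MvPowerSeries.X j) • (const (e j : g) : Series ι g) with hZ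
  have hZm : ∀ m, Z m =
      ((∑ j, MvPowerSeries.coeff m (Θ (MvPowerSeries.X j)) • e j : V) : g) := by
    intro m
    rw [hZ, Series.sum_apply]
    simp [smul_const_apply]
  have key : ∀ N, Z ∈ below ι g N := by
    intro N
    induction N with
    | zero => exact mem_below_zero Z
    | succ N ih =>
      intro m hm
      have h1 := h m
      rw [mcForm_eq_eval, ← hZ, eval_apply_of_mem_below _ _ ih (Nat.lt_succ_iff.1 hm)] at h1
      have h2 : Z m ∈ i.toSubmodule := by simpa [oneSubExpDiv] using h1
      exact Submodule.disjoint_def.1 hV.disjoint _ (hZm m ▸ Submodule.coe_mem _) h2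
  refine formalVF_eq_zero fun j => ?_
  ext m
  have h1 := key (m.degree + 1) m (Nat.lt_succ_self _)
  rw [hZm, Submodule.coe_eq_zero] at h1
  exact Fintype.linearIndependent_iff.1 e.linearIndependent _ h1 j

theorem eq_of_mcForm_sub_mem (hV : IsCompl V i.toSubmodule) {Θ Ξ : FormalVF ι}
    (h : mcForm (frame e) Θ - mcForm (frame e) Ξ ∈ valuesIn ι i.toSubmodule) : Θ = Ξ := by
  rw [← map_sub] at h
  exact sub_eq_zero.1 (eq_zero_of_mcForm_mem e hV h)

end Fields

/-! ### The anti-isomorphism X ↦ R*_X and the isotropy subalgebra. -/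

section Fields

open Series

variable {g : Type*} [LieRing g] [LieAlgebra ℝ g] {i : LieSubalgebra ℝ g} {V : Submodule ℝ g}
  {ι : Type*} [Fintype ι]

variable (hV : IsCompl V i.toSubmodule) (e : Module.Basis ι ℝ V)

theorem expAd_add (u : ι → g) (X Y : g) : expAd u (X + Y) = expAd u X + expAd u Y := by
  simp [expAd]

theorem expAd_smul (u : ι → g) (c : ℝ) (X : g) : expAd u (c • X) = c • expAd u X := by
  rw [expAd, expAd, map_smul, ← C_smul, map_smul, C_smul]

/-- The `i`-part of `exp(-v)_* X`, modulo which it is the Maurer-Cartan form of `R*_X`. -/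
abbrev isotropyR (X : g) : Series ι g := isotropySeries hV e (fun h => (-1) ^ h * b h) X

theorem isotropyR_mem (X : g) : isotropyR hV e X ∈ valuesIn ι i.toSubmodule :=
  isotropySeries_mem hV e _ X

theorem expAd_sub_mcForm_Rstar (X : g) :
    expAd (frame e) X - mcForm (frame e) (Rstar hV e X) ∈ valuesIn ι i.toSubmodule := by
  rw [mcForm_Rstar, sub_sub_cancel]
  exact isotropyR_mem hV e X

theorem const_sub_mcForm_Lstar (X : g) :
    const X - mcForm (frame e) (Lstar hV e X) ∈ valuesIn ι i.toSubmodule := by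
  rw [mcForm_Lstar, sub_sub_cancel]
  exact isotropySeries_mem hV e _ X

/-- Put E = e^{-ad v} X, so ω(R*_X) = E - H. In the Maurer-Cartan equation -Θ(E) = [ω(Θ), E] cancels
[E, ω(Θ)], and the remaining error Θ(H) lies in 𝓕 ⊗ i. -/
theorem mcForm_Rstar_lie_sub (X : g) (Θ : FormalVF ι) :
    mcForm (frame e) ⁅Rstar hV e X, Θ⁆ - (der (Rstar hV e X) (mcForm (frame e) Θ) -
      ⁅isotropyR hV e X, mcForm (frame e) Θ⁆) ∈ valuesIn ι i.toSubmodule := by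
  have h : mcForm (frame e) ⁅Rstar hV e X, Θ⁆ - (der (Rstar hV e X) (mcForm (frame e) Θ) -
      ⁅isotropyR hV e X, mcForm (frame e) Θ⁆) = der Θ (isotropyR hV e X) := by
    rw [Series.mcForm_lie, mcForm_Rstar, map_sub, der_expAd, sub_lie,
      ← lie_skew (mcForm (frame e) Θ) (expAd (frame e) X)]
    abel
  rw [h]
  exact der_mem_valuesIn Θ (isotropyR_mem hV e X)

theorem Rstar_add (X Y : g) : Rstar hV e (X + Y) = Rstar hV e X + Rstar hV e Y := by
  refine eq_of_mcForm_sub_mem e hV ?_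
  have := sub_mem (add_mem (expAd_sub_mcForm_Rstar hV e X) (expAd_sub_mcForm_Rstar hV e Y))
    (expAd_sub_mcForm_Rstar hV e (X + Y))
  rw [expAd_add] at this
  rw [map_add]
  convert this using 1
  abel

theorem Rstar_smul (c : ℝ) (X : g) : Rstar hV e (c • X) = c • Rstar hV e X := by
  refine eq_of_mcForm_sub_mem e hV ?_
  have := sub_mem ((valuesIn ι i.toSubmodule).smul_mem (MvPowerSeries.C c)
    (expAd_sub_mcForm_Rstar hV e X)) (expAd_sub_mcForm_Rstar hV e (c • X))
  rw [expAd_smul, C_smul, smul_sub] at this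
  rw [LinearMap.map_smul_of_tower]
  convert this using 1
  abel

theorem Rstar_lie (X Y : g) : Rstar hV e ⁅X, Y⁆ = -⁅Rstar hV e X, Rstar hV e Y⁆ := by
  refine eq_of_mcForm_sub_mem e hV ?_
  have h1 := mcForm_Rstar_lie_sub hV e X (Rstar hV e Y)
  have h2 := expAd_sub_mcForm_Rstar hV e ⁅X, Y⁆
  have h3 := der_mem_valuesIn (Rstar hV e X) (isotropyR_mem hV e Y)
  have h4 : ⁅isotropyR hV e X, isotropyR hV e Y⁆ ∈ valuesIn ι i.toSubmodule :=
    lie_mem_valuesIn (fun _ h _ h' => i.lie_mem h h') (isotropyR_mem hV e X) (isotropyR_mem hV e Y)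
  -- The derivative of e^{-ad v} Y along R*_X is -[e^{-ad v} X - H, e^{-ad v} Y]; its H-part cancels
  -- against the bracket, and e^{-ad v} respects brackets.
  have h5 : der (Rstar hV e X) (mcForm (frame e) (Rstar hV e Y)) -
      ⁅isotropyR hV e X, mcForm (frame e) (Rstar hV e Y)⁆ =
      -expAd (frame e) ⁅X, Y⁆ - der (Rstar hV e X) (isotropyR hV e Y) +
        ⁅isotropyR hV e X, isotropyR hV e Y⁆ := by
    rw [mcForm_Rstar hV e Y, map_sub, der_expAd, mcForm_Rstar, sub_lie, lie_expAd, lie_sub]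
    abel
  rw [h5] at h1
  have h6 := add_mem (sub_mem (sub_mem h1 h2) h3) h4
  rw [map_neg]
  convert h6 using 1
  abel

/-- The linear map `X ↦ R*_X`. -/
def RstarHom : g →ₗ[ℝ] FormalVF ι where
  toFun := Rstar hV e
  map_add' := Rstar_add hV e
  map_smul' := Rstar_smul hV e

theorem proj_eq_of_sub_mem {X : g} {v : V} (h : X - v ∈ i) : proj hV X = v := by
  rwa [← proj_eq_zero_iff hV, map_sub, proj_coe, sub_eq_zero] at h

theorem valueAtZero_Rstar (X : g) : valueAtZero e (Rstar hV e X) = proj hV X := by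
  refine (proj_eq_of_sub_mem hV ?_).symm
  have h := expAd_sub_mcForm_Rstar hV e X 0
  rwa [Series.sub_apply, expAd_zero, mcForm_apply_zero] at h

theorem valueAtZero_Lstar (X : g) : valueAtZero e (Lstar hV e X) = proj hV X := by
  refine (proj_eq_of_sub_mem hV ?_).symm
  have h := const_sub_mcForm_Lstar hV e X 0
  rwa [Series.sub_apply, const_zero, mcForm_apply_zero] at h

theorem mem_iff_Rstar_mem_der₀ (X : g) : X ∈ i ↔ Rstar hV e X ∈ der₀ ι := by
  rw [← valueAtZero_eq_zero_iff e, valueAtZero_Rstar, proj_eq_zero_iff]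

/-- The kernel of `X ↦ R*_X`. -/
def kerRstar : LieIdeal ℝ g where
  __ := LinearMap.ker (RstarHom hV e)
  lie_mem := by
    intro X Y hY
    have h : Rstar hV e Y = 0 := hY
    change Rstar hV e ⁅X, Y⁆ = 0
    rw [Rstar_lie, h]
    exact neg_eq_zero.2 (lie_zero (L := FormalVF ι) (M := FormalVF ι) _)

theorem Rstar_injective (h : ∀ I : LieIdeal ℝ g, (I : Set g) ⊆ (i : Set g) → I = ⊥) :
    Function.Injective (Rstar hV e) := by
  have h1 : kerRstar hV e = ⊥ := by
    refine h _ fun X hX => (mem_iff_Rstar_mem_der₀ hV e X).2 ?_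
    have hX' : Rstar hV e X = 0 := hX
    rw [hX']
    exact Submodule.zero_mem _
  refine (injective_iff_map_eq_zero (RstarHom hV e)).2 fun X hX => ?_
  have hX' : X ∈ kerRstar hV e := hX
  rwa [h1, LieSubmodule.mem_bot] at hX'

/-! ### The correspondence between `i`-submodules and invariant modules -/

variable {l : Submodule ℝ g}

theorem mem_of_proj_mem (hl : i.toSubmodule ≤ l) {Y : g} (h : (proj hV Y : g) ∈ l) : Y ∈ l := by
  have := l.add_mem (hl (sub_proj_mem hV Y)) h
  rwa [sub_add_cancel] at this

theorem proj_mem (hl : i.toSubmodule ≤ l) {Y : g} (h : Y ∈ l) : (proj hV Y : g) ∈ l := by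
  have := l.sub_mem h (hl (sub_proj_mem hV Y))
  rwa [sub_sub_cancel] at this

theorem constantCoeff_apply_X (Θ : FormalVF ι) (j : ι) :
    MvPowerSeries.constantCoeff (Θ (MvPowerSeries.X j)) = e.repr (valueAtZero e Θ) j := by
  rw [valueAtZero_apply, e.repr_sum_self]

theorem mcForm_mem_of_mem_toModule (hl : i.toSubmodule ≤ l) {Θ : FormalVF ι}
    (h : Θ ∈ toModule hV e l) : mcForm (frame e) Θ ∈ valuesIn ι l := by
  have h1 : toModule hV e l ≤ (valuesIn ι l).comap (mcForm (frame e)) := by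
    rw [toModule, Submodule.span_le]
    rintro _ ⟨w, ⟨-, hw⟩, rfl⟩
    have := sub_mem (const_mem_valuesIn hw) (valuesIn_mono hl (const_sub_mcForm_Lstar hV e w))
    rwa [sub_sub_cancel] at this
  exact h1 h

/-- Take a basis w_k of V ∩ l and expand the projection of ω(Θ) to V in it: then ω(Θ) ≡ ∑ z_k w_k ≡
ω(∑ z_k L*_{w_k}) modulo 𝓕 ⊗ i. The clause on z_k in 𝓕₀ serves Nakayama's lemma. -/
theorem exists_generators (hl : i.toSubmodule ≤ l) :
    ∃ (n : ℕ) (w : Fin n → g), (∀ k, w k ∈ V ∧ w k ∈ l) ∧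
      ∀ Θ : FormalVF ι, mcForm (frame e) Θ ∈ valuesIn ι l →
        ∃ z : Fin n → FormalFun ι, Θ = ∑ k, z k • Lstar hV e (w k) ∧
          (valueAtZero e Θ = 0 → ∀ k, z k ∈ formalFun₀ ι) := by
  have : FiniteDimensional ℝ V := Module.Finite.of_basis e
  have : FiniteDimensional ℝ (V ⊓ l : Submodule ℝ g) :=
    Submodule.finiteDimensional_inf_left V l
  let β := Module.finBasis ℝ (V ⊓ l : Submodule ℝ g)
  refine ⟨_, fun k => (β k : g), fun k => (β k).2, fun Θ hΘ => ?_⟩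
  let p : (ι →₀ ℕ) → (V ⊓ l : Submodule ℝ g) := fun m =>
    ⟨proj hV (mcForm (frame e) Θ m), Submodule.coe_mem _, proj_mem hV hl (hΘ m)⟩
  let z : Fin _ → FormalFun ι := fun k m => β.repr (p m) k
  have hz : ∀ k m, MvPowerSeries.coeff m (z k) = β.repr (p m) k := fun _ _ => rfl
  refine ⟨z, eq_of_mcForm_sub_mem e hV ?_, fun h0 k => ?_⟩
  · have h1 : mcForm (frame e) Θ - ∑ k, z k • (const (β k : g) : Series ι g) ∈
        valuesIn ι i.toSubmodule := by
      intro m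
      have h2 := congrArg (V ⊓ l).subtype (β.sum_repr (p m))
      simp only [map_sum, map_smul, Submodule.subtype_apply] at h2
      rw [Series.sub_apply, Series.sum_apply]
      simp only [smul_const_apply, hz]
      rw [h2]
      exact sub_proj_mem hV _
    have h2 : ∑ k, z k • (const (β k : g) - mcForm (frame e) (Lstar hV e (β k : g))) ∈
        valuesIn ι i.toSubmodule :=
      Submodule.sum_mem _ fun k _ => Submodule.smul_mem _ _ (const_sub_mcForm_Lstar hV e _)
    have h3 := add_mem h1 h2
    simp only [smul_sub, sum_sub_distrib] at h3
    rw [map_sum]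
    simp only [map_smul]
    rwa [sub_add_sub_cancel] at h3
  · rw [formalFun₀, RingHom.mem_ker, ← MvPowerSeries.coeff_zero_eq_constantCoeff_apply, hz]
    have h1 : p 0 = 0 := by
      apply Subtype.ext
      change (proj hV (mcForm (frame e) Θ 0) : g) = 0
      rw [mcForm_apply_zero, h0]
      simp
    rw [h1, map_zero, Finsupp.zero_apply]

theorem mem_toModule_iff (hl : i.toSubmodule ≤ l) {Θ : FormalVF ι} :
    Θ ∈ toModule hV e l ↔ mcForm (frame e) Θ ∈ valuesIn ι l := by
  refine ⟨mcForm_mem_of_mem_toModule hV e hl, fun h => ?_⟩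
  obtain ⟨n, w, hw, H⟩ := exists_generators hV e hl
  obtain ⟨z, rfl, -⟩ := H Θ h
  exact Submodule.sum_mem _ fun k _ =>
    Submodule.smul_mem _ _ (Submodule.subset_span ⟨w k, hw k, rfl⟩)

theorem toModule_fg (hl : i.toSubmodule ≤ l) : (toModule hV e l).FG := by
  obtain ⟨n, w, hw, H⟩ := exists_generators hV e hl
  refine Submodule.fg_def.2 ⟨Set.range fun k => Lstar hV e (w k), Set.finite_range _,
    le_antisymm ?_ fun Θ h => ?_⟩
  · rw [Submodule.span_le]
    rintro _ ⟨k, rfl⟩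
    exact Submodule.subset_span ⟨w k, hw k, rfl⟩
  · obtain ⟨z, rfl, -⟩ := H Θ (mcForm_mem_of_mem_toModule hV e hl h)
    exact Submodule.sum_mem _ fun k _ =>
      Submodule.smul_mem _ _ (Submodule.subset_span ⟨k, rfl⟩)

theorem mem_smul_toModule (hl : i.toSubmodule ≤ l) {Θ : FormalVF ι} (h : Θ ∈ toModule hV e l)
    (h0 : valueAtZero e Θ = 0) : Θ ∈ formalFun₀ ι • toModule hV e l := by
  obtain ⟨n, w, hw, H⟩ := exists_generators hV e hl
  obtain ⟨z, rfl, hz⟩ := H Θ (mcForm_mem_of_mem_toModule hV e hl h)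
  exact Submodule.sum_mem _ fun k _ =>
    Submodule.smul_mem_smul (hz h0 k) (Submodule.subset_span ⟨w k, hw k, rfl⟩)

theorem toModule_mem_invariantModules (hl : l ∈ isotropySubmodules i) :
    toModule hV e l ∈ invariantModules hV e := by
  intro X Θ hΘ
  rw [mem_toModule_iff hV e hl.1] at hΘ ⊢
  have h1 := valuesIn_mono hl.1 (mcForm_Rstar_lie_sub hV e X Θ)
  have h2 := der_mem_valuesIn (Rstar hV e X) hΘ
  have h3 := lie_mem_valuesIn (l := i.toSubmodule) hl.2 (isotropyR_mem hV e X) hΘ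
  simpa using add_mem h1 (sub_mem h2 h3)

theorem ofModule_toModule (hl : l ∈ isotropySubmodules i) :
    ofModule hV e (toModule hV e l) = l := by
  ext Y
  rw [mem_ofModule]
  constructor
  · rintro ⟨Θ, hΘ, h⟩
    refine mem_of_proj_mem hV hl.1 ?_
    rw [h, ← mcForm_apply_zero]
    exact (mem_toModule_iff hV e hl.1).1 hΘ 0
  · intro hY
    refine ⟨Lstar hV e (proj hV Y : g), Submodule.subset_span
      ⟨_, ⟨Submodule.coe_mem _, proj_mem hV hl.1 hY⟩, rfl⟩, ?_⟩
    rw [valueAtZero_Lstar, proj_coe]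

variable {M : Submodule (FormalFun ι) (FormalVF ι)}

theorem le_ofModule : i.toSubmodule ≤ ofModule hV e M := by
  intro X hX
  rw [mem_ofModule]
  exact ⟨0, M.zero_mem, by rw [map_zero]; exact (proj_eq_zero_iff hV X).2 hX⟩

theorem ofModule_mem_isotropySubmodules (hM : M ∈ invariantModules hV e) :
    ofModule hV e M ∈ isotropySubmodules i := by
  refine ⟨le_ofModule hV e, fun X hX Y hY => ?_⟩
  rw [mem_ofModule] at hY ⊢
  obtain ⟨Θ, hΘ, h⟩ := hY
  -- At 0 the derivative along R*_X drops out and H(0) = X, so the main congruence gives [R*_X,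
  -- Θ](0) ≡ -[X, Θ(0)] ≡ -[X, Y] modulo `i`.
  refine ⟨-⁅Rstar hV e X, Θ⁆, M.neg_mem (hM X Θ hΘ), proj_eq_of_sub_mem hV ?_⟩
  have h1 := mcForm_Rstar_lie_sub hV e X Θ 0
  have h2 : isotropyR hV e X 0 = X := by
    have h3 := congrArg (fun Z => Z 0) (mcForm_Rstar hV e X)
    simp only [mcForm_apply_zero, Series.sub_apply, expAd_zero, valueAtZero_Rstar] at h3
    rw [(proj_eq_zero_iff hV X).2 hX, Submodule.coe_zero] at h3
    exact (sub_eq_zero.1 h3.symm).symm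
  rw [Series.sub_apply, Series.sub_apply, lie_apply_zero, h2,
    der_apply_zero ((mem_iff_Rstar_mem_der₀ hV e X).1 hX), mcForm_apply_zero, mcForm_apply_zero,
    ← h, zero_sub, sub_neg_eq_add] at h1
  have h3 := i.add_mem h1 (i.lie_mem hX (sub_proj_mem hV Y))
  rw [map_neg, Submodule.coe_neg, sub_neg_eq_add]
  rw [lie_sub] at h3
  convert h3 using 1
  abel

theorem smul_apply_sub_mem (f : FormalFun ι) {Z : Series ι g} {m : ι →₀ ℕ}
    (h : ∀ p : ι →₀ ℕ, p.degree < m.degree → Z p ∈ l) :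
    (f • Z) m - MvPowerSeries.constantCoeff f • Z m ∈ l := by
  rw [← real_smul_apply, ← C_smul, ← Series.sub_apply, ← sub_smul, Series.smul_apply]
  refine l.sum_mem fun p hp => ?_
  rw [mem_antidiagonal] at hp
  by_cases hp1 : p.1 = 0
  · simp [hp1]
  · refine l.smul_mem _ (h _ ?_)
    have h1 : p.1.degree ≠ 0 := fun h => hp1 ((Finsupp.degree_eq_zero_iff _).1 h)
    rw [← hp, map_add]
    omega

/-- R*_{e_j} has value e_j at 0, so it differs from ∂/∂x_j by a field vanishing at 0, whose action
does not lower degrees. -/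
theorem der_Rstar_apply_sub_mem (j : ι) {Z : Series ι g} {m : ι →₀ ℕ}
    (h : ∀ p : ι →₀ ℕ, p.degree ≤ m.degree → Z p ∈ l) :
    der (Rstar hV e (e j : g)) Z m - pd j Z m ∈ l := by
  have h1 : ∀ k, MvPowerSeries.constantCoeff (Rstar hV e (e j : g) (MvPowerSeries.X k)) =
      if j = k then 1 else 0 := by
    intro k
    rw [constantCoeff_apply_X e, valueAtZero_Rstar, proj_coe, e.repr_self, Finsupp.single_apply]
  have h2 : pd j Z m = ∑ k,
      MvPowerSeries.constantCoeff (Rstar hV e (e j : g) (MvPowerSeries.X k)) • pd k Z m := by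
    simp [h1, ite_smul]
  rw [h2, der_apply, Series.sum_apply, ← sum_sub_distrib]
  refine l.sum_mem fun k _ => smul_apply_sub_mem _ fun p hp => l.smul_mem _ (h _ ?_)
  rw [map_add, Finsupp.degree_single]
  omega

/-- By induction on the degree, for all Θ in M at once since the step passes to [R*_{e_j}, Θ]. In
degree |n| the main congruence expresses ∂/∂x_j ω(Θ), modulo terms already known to lie in l, by
ω([R*_{e_j}, Θ]); this reaches the coefficients of ω(Θ) in degree |n| + 1. -/
theorem mcForm_apply_mem_ofModule (hM : M ∈ invariantModules hV e) (N : ℕ) :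
    ∀ Θ ∈ M, ∀ m : ι →₀ ℕ, m.degree < N → mcForm (frame e) Θ m ∈ ofModule hV e M := by
  have hl := ofModule_mem_isotropySubmodules hV e hM
  induction N with
  | zero => intro Θ _ m hm; omega
  | succ N ih =>
    intro Θ hΘ m hm
    by_cases hm0 : m = 0
    · rw [hm0, mcForm_apply_zero, mem_ofModule]
      exact ⟨Θ, hΘ, proj_coe hV _⟩
    · obtain ⟨j, hj⟩ := Finsupp.ne_iff.1 hm0
      obtain ⟨n, rfl⟩ : ∃ n, n + Finsupp.single j 1 = m := ⟨_, sub_single_add_single hj⟩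
      rw [map_add, Finsupp.degree_single] at hm
      have h1 := hl.1 (mcForm_Rstar_lie_sub hV e (e j : g) Θ n)
      have h2 := ih _ (hM (e j : g) Θ hΘ) n (by omega)
      have h3 := der_Rstar_apply_sub_mem hV e (l := ofModule hV e M) j
        (Z := mcForm (frame e) Θ) (m := n) fun p hp => ih Θ hΘ p (by omega)
      have h4 : ⁅isotropyR hV e (e j : g), mcForm (frame e) Θ⁆ n ∈ ofModule hV e M := by
        rw [lie_apply]
        refine Submodule.sum_mem _ fun p hp => hl.2 _ (isotropyR_mem hV e _ _) _ (ih Θ hΘ _ ?_)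
        rw [mem_antidiagonal] at hp
        have := congrArg Finsupp.degree hp
        rw [map_add] at this
        omega
      have h5 := Submodule.sub_mem _ (Submodule.sub_mem _ (Submodule.add_mem _ h2 h4) h1) h3
      have h6 : pd j (mcForm (frame e) Θ) n ∈ ofModule hV e M := by
        rw [Series.sub_apply, Series.sub_apply] at h5
        convert h5 using 1
        abel
      rw [pd_apply] at h6
      have hne : ((n j : ℝ) + 1) ≠ 0 := by positivity
      exact (Submodule.smul_mem_iff _ hne).1 h6

theorem le_toModule_ofModule (hM : M ∈ invariantModules hV e) :
    M ≤ toModule hV e (ofModule hV e M) := fun Θ hΘ =>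
  (mem_toModule_iff hV e (le_ofModule hV e)).2 fun m =>
    mcForm_apply_mem_ofModule hV e hM (m.degree + 1) Θ hΘ m (Nat.lt_succ_self _)

/-- Nakayama over the local ring 𝓕: each generator L*_w of l* has the value at 0 of some Θ in M ⊆
l*, so L*_w - Θ lies in 𝓕₀ l*. Hence l* ⊆ M + 𝓕₀ l*, and l* is finitely generated. -/
theorem toModule_ofModule (hM : M ∈ invariantModules hV e) :
    toModule hV e (ofModule hV e M) = M := by
  refine le_antisymm ?_ (le_toModule_ofModule hV e hM)
  refine Submodule.le_of_le_smul_of_le_jacobson_bot (I := formalFun₀ ι)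
    (toModule_fg hV e (le_ofModule hV e)) ?_ ?_
  · rw [IsLocalRing.jacobson_eq_maximalIdeal ⊥ bot_ne_top]
    exact IsLocalRing.le_maximalIdeal (RingHom.ker_ne_top _)
  · conv_lhs => rw [toModule]
    rw [Submodule.span_le]
    rintro _ ⟨w, hw, rfl⟩
    obtain ⟨Θ, hΘ, h⟩ := (mem_ofModule hV e M w).1 hw.2
    refine Submodule.mem_sup.2 ⟨Θ, hΘ, Lstar hV e w - Θ,
      mem_smul_toModule hV e (le_ofModule hV e)
        (sub_mem (Submodule.subset_span ⟨w, hw, rfl⟩) (le_toModule_ofModule hV e hM hΘ)) ?_,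
      add_sub_cancel _ _⟩
    rw [map_sub, valueAtZero_Lstar, h, sub_self]

/-- The image `g*` of `X ↦ R*_X`. -/
def rangeRstar : LieSubalgebra ℝ (FormalVF ι) where
  __ := LinearMap.range (RstarHom hV e)
  lie_mem' := by
    rintro _ _ ⟨X, rfl⟩ ⟨Y, rfl⟩
    refine ⟨-⁅X, Y⁆, ?_⟩
    rw [map_neg, neg_eq_iff_eq_neg]
    exact Rstar_lie hV e X Y

end Fields

end

end TransitiveGeometry

theorem theorem7p4 {g : Type*} [LieRing g] [LieAlgebra ℝ g] [TopologicalSpace g]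
    (i : LieSubalgebra ℝ g) (hi : TransitiveGeometry.IsTransitivePair i)
    (V : Submodule ℝ g) (hV : IsCompl V i.toSubmodule)
    {ι : Type*} [Fintype ι] (e : Module.Basis ι ℝ V) :
    Function.Injective (TransitiveGeometry.Rstar hV e) ∧
    (∃ (gstar : LieSubalgebra ℝ (TransitiveGeometry.FormalVF ι)) (Φ : g ≃ₗ[ℝ] gstar),
      (gstar : Set (TransitiveGeometry.FormalVF ι)) = Set.range (TransitiveGeometry.Rstar hV e) ∧
      (∀ X : g, (Φ X : TransitiveGeometry.FormalVF ι) = TransitiveGeometry.Rstar hV e X) ∧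
      ∀ X Y : g, Φ ⁅X, Y⁆ = -⁅Φ X, Φ Y⁆) ∧
    (i : Set g) = {X : g | TransitiveGeometry.Rstar hV e X ∈ TransitiveGeometry.der₀ ι} ∧
    Set.BijOn (TransitiveGeometry.toModule hV e) (TransitiveGeometry.isotropySubmodules i)
      (TransitiveGeometry.invariantModules hV e) ∧
    Set.InvOn (TransitiveGeometry.ofModule hV e) (TransitiveGeometry.toModule hV e)
      (TransitiveGeometry.isotropySubmodules i) (TransitiveGeometry.invariantModules hV e) := by
  have hinj := TransitiveGeometry.Rstar_injective hV e hi.eq_bot_of_ideal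
  have hinv : Set.InvOn (TransitiveGeometry.ofModule hV e) (TransitiveGeometry.toModule hV e)
      (TransitiveGeometry.isotropySubmodules i) (TransitiveGeometry.invariantModules hV e) :=
    ⟨fun l hl => TransitiveGeometry.ofModule_toModule hV e hl,
      fun M hM => TransitiveGeometry.toModule_ofModule hV e hM⟩
  refine ⟨hinj, ⟨TransitiveGeometry.rangeRstar hV e,
    LinearEquiv.ofInjective (TransitiveGeometry.RstarHom hV e) hinj, rfl, fun X => rfl,
    fun X Y => Subtype.ext (TransitiveGeometry.Rstar_lie hV e X Y)⟩,
    Set.ext fun X => TransitiveGeometry.mem_iff_Rstar_mem_der₀ hV e X,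
    hinv.bijOn (fun l hl => TransitiveGeometry.toModule_mem_invariantModules hV e hl)
      fun M hM => TransitiveGeometry.ofModule_mem_isotropySubmodules hV e hM, hinv⟩
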